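/- Let $d\ge 1$. For $\mathbf k\in\mathbb Z^d$ put $|\mathbf k|=\max_v|k_v|$ and $\langle\mathbf k\rangle=\max\{1,|\mathbf k|\}$; for $\omega\in\mathbb R^d$ put $\mathbf i\cdot\omega=\sum_v i_v\omega_v$, and let $\|x\|_{\mathbb R/\mathbb Z}=\inf_{k\in\mathbb Z}|x-k|$ and $x \bmod 1\in[0,1)$ be the fractional part. Let $\mathfrak I$ be the space of functions on $\mathbb R$ of period $1$ and bounded variation, with norm $\|f\|_{\mathfrak I}=\sup_{x}|f(x)|+\|f\|_{BV}$, where $\|f\|_{BV}$ is the total variation over the period $[0,1]$. For $\phi:\mathbb Z^d\to\mathbb R$ let $(T_\phi u)_{\mathbf i}=\sum_{\mathbf j}\phi_{\mathbf i-\mathbf j}u_{\mathbf j}$ on $\ell^2(\mathbb Z^d)$ (complex sequences). For an infinite matrix $A=(a_{\mathbf i,\mathbf j})$ let $\|A\|_r^2=\sum_{\mathbf k}\|A_{\mathbf k}\|_{\mathfrak B}^2\langle\mathbf k\rangle^{2r}$, where $A_{\mathbf k}=(a_{\mathbf i,\mathbf i-\mathbf k})_{\mathbf i}$ and $\|a\|_{\mathfrak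 B}=\inf\{\|f\|_{\mathfrak I}: f\in\mathfrak I \text{ complex-valued},\ f(\mathbf i\cdot\omega)=a_{\mathbf i}\ \forall\,\mathbf i\}$; in particular $\|T_\phi\|_r^2=\sum_{\mathbf k}|\phi_{\mathbf k}|^2\langle\mathbf k\rangle^{2r}$. Fix $\alpha_0>d/2$, $\tau>0$, $\delta>0$ and $s>\alpha_0+\tau+d/2+12\delta$. There is a constant $C=C(s,d,\delta,\tau,\alpha_0)>0$, and for every $\gamma>0$ there is $\epsilon_0=\epsilon_0(s,d,\delta,\tau,\gamma,\alpha_0)>0$, such that the following holds. Let $\omega\in\mathbb R^d$ satisfy $\|\mathbf i\cdot\omega\|_{\mathbb R/\mathbb Z}\ge\gamma|\mathbf i|^{-\tau}$ for all $\mathbf i\ne\mathbf 0$, let $\phi$ satisfy $\phi_{\mathbf 0}=0$ and $|\phi_{\mathbf i}|\le|\mathbf i|^{-s}$ for all $\mathbf i\neq\mathbf 0$, and suppose $\|T_\phi\|_{s-d/2-\delta}\le\epsilon_0$. Then there is a real-valued $d'\in\mathfrak I$ with $$\|(x \bmod 1)-d'\|_{\mathfrak I}\le C\,\|T_\phi\|_{s-d/2-\delta}^{\frac1{s-d/2-5\delta-\alpha_0}}$$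 such that $H'=T_\phi+d'(\mathbf i\cdot\omega)\delta_{\mathbf i\mathbf i'}$ is a bounded operator on $\ell^2(\mathbb Z^d)$ that has pure point spectrum (its eigenvectors span a dense subspace), with a complete set $\{e_{\mathbf k}\}_{\mathbf k\in\mathbb Z^d}$ (that is, one with dense linear span) of normalized eigenfunctions, $\|e_{\mathbf k}\|_{\ell^2}=1$, $H'e_{\mathbf k}=(\mathbf k\cdot\omega \bmod 1)\,e_{\mathbf k}$, which are polynomially localized: $$|(e_{\mathbf k})_{\mathbf i}|\le 2\langle\mathbf i-\mathbf k\rangle^{-s+\tau+d/2+12\delta}\qquad(\mathbf i,\mathbf k\in\mathbb Z^d).$$ Moreover, the point spectrum (set of eigenvalues) of $H'$ is exactly $\{\mathbf i\cdot\omega \bmod 1:\ \mathbf i\in\mathbb Z^d\}$. -/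

import Mathlib

open scoped ENNReal

noncomputable section

/-- The lattice `ℤ^d`. Its Mathlib norm `‖i‖` is the sup norm `max_v |i_v|`. -/
abbrev IntLat (d : ℕ) : Type := Fin d → ℤ

/-- The complex Hilbert space `ℓ²(ℤ^d)`. -/
abbrev EllTwo (d : ℕ) : Type := lp (fun _ : IntLat d => ℂ) 2

/-- `⟨k⟩ = max {1, |k|}`. -/
def japanese {d : ℕ} (k : IntLat d) : ℝ := max 1 ‖k‖

/-- `i · ω = ∑ v, i_v ω_v`. -/
def phase {d : ℕ} (ω : Fin d → ℝ) (i : IntLat d) : ℝ := ∑ v, (i v : ℝ) * ω v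

/-- `‖x‖_{ℝ/ℤ} = inf_{k ∈ ℤ} |x - k|`. -/
def distToInt (x : ℝ) : ℝ := ⨅ k : ℤ, |x - (k : ℝ)|

/-- The Diophantine condition `‖i · ω‖_{ℝ/ℤ} ≥ γ / |i|^τ` for all `i ≠ 0`. -/
def IsDiophantine {d : ℕ} (τ γ : ℝ) (ω : Fin d → ℝ) : Prop :=
  ∀ i : IntLat d, i ≠ 0 → γ / ‖i‖ ^ τ ≤ distToInt (phase ω i)

section BoundedVariation

variable {E : Type*} [NormedAddCommGroup E]

/-- `sup_x |f x|` plus the total variation of `f` over one (closed) period, in `[0, ∞]`. -/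
def bvNorm (f : ℝ → E) : ℝ≥0∞ := (⨆ x : ℝ, ‖f x‖ₑ) + eVariationOn f (Set.Icc 0 1)

/-- The functions of period `1` and of bounded variation. -/
def IsPeriodicBV (f : ℝ → E) : Prop := Function.Periodic f 1 ∧ bvNorm f < ⊤

end BoundedVariation

/-- The norm of the translation invariant Banach algebra of sequences `a_i = f (i · ω)` with `f`
periodic of bounded variation: the infimum of the norms of all such `f`. It is `∞` exactly when
`a` is not of this form. -/
def seqNorm {d : ℕ} (ω : Fin d → ℝ) (a : IntLat d → ℂ) : ℝ≥0∞ :=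
  ⨅ (f : ℝ → ℂ) (_ : IsPeriodicBV f ∧ ∀ i, f (phase ω i) = a i), bvNorm f

/-- The `k`-diagonal `A_k = (a_{i, i - k})_i` of an infinite matrix. -/
def kDiagonal {d : ℕ} (A : Matrix (IntLat d) (IntLat d) ℂ) (k : IntLat d) : IntLat d → ℂ :=
  fun i => A i (i - k)

/-- The Sobolev norm `‖A‖_r`, with `‖A‖_r ^ 2 = ∑_k ‖A_k‖ ^ 2 ⟨k⟩ ^ (2 r)`, valued in `[0, ∞]`. -/
def sobolevNorm {d : ℕ} (ω : Fin d → ℝ) (r : ℝ) (A : Matrix (IntLat d) (IntLat d) ℂ) : ℝ≥0∞ :=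
  (∑' k : IntLat d,
    seqNorm ω (kDiagonal A k) ^ 2 * ENNReal.ofReal (japanese k ^ (2 * r))) ^ (1 / 2 : ℝ)

/-- The matrix `(φ_{i - j})` of the hopping operator `T_φ`. -/
def hopping {d : ℕ} (φ : IntLat d → ℝ) : Matrix (IntLat d) (IntLat d) ℂ :=
  fun i j => (φ (i - j) : ℂ)

/-- `|φ_i| ≤ |i|^{-s}` for `i ≠ 0`, and `φ_0 = 0`. -/
def IsPolynomialSymbol {d : ℕ} (s : ℝ) (φ : IntLat d → ℝ) : Prop :=
  (∀ i : IntLat d, i ≠ 0 → |φ i| ≤ ‖i‖ ^ (-s)) ∧ φ 0 = 0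

/-- `H` is the bounded operator on `ℓ²(ℤ^d)` with `(H u)_i = ∑_j a_{i, j} u_j`
(convergent sums); there is at most one such `H`. -/
def IsOperatorOf {d : ℕ} (H : EllTwo d →L[ℂ] EllTwo d)
    (A : Matrix (IntLat d) (IntLat d) ℂ) : Prop :=
  ∀ (u : EllTwo d) (i : IntLat d), HasSum (fun j => A i j * u j) (H u i)

/-- The point spectrum: the set of eigenvalues. -/
def pointSpectrum {d : ℕ} (H : EllTwo d →L[ℂ] EllTwo d) : Set ℂ :=
  {μ | Module.End.HasEigenvalue (H : Module.End ℂ (EllTwo d)) μ}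

/-- A family of vectors is complete if its closed linear span is the whole space. -/
def IsCompleteFamily {d : ℕ} (e : IntLat d → EllTwo d) : Prop :=
  (Submodule.span ℂ (Set.range e)).topologicalClosure = ⊤

/-- Pure point spectrum (for an operator that need not be self-adjoint): the eigenvectors are
complete. -/
def HasPurePointSpectrum {d : ℕ} (H : EllTwo d →L[ℂ] EllTwo d) : Prop :=
  (⨆ μ : ℂ, Module.End.eigenspace (H : Module.End ℂ (EllTwo d)) μ).topologicalClosure = ⊤

end

noncomputable section

open Filter Topology

/-! Let D be the diagonal matrix with entries i·ω mod 1. It suffices to find a real diagonal V and a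
small W with (D + T_φ + V)(1 + W) = (1 + W)D. Then d' is (x mod 1) + V, the operator 1 + W is
invertible by a Neumann series, and its columns are eigenvectors that inherit the off-diagonal decay
of W. Matrices are handled through their diagonals, which are periodic BV functions sampled along
i·ω; the matrix product becomes a twisted convolution.

The equation is solved by a KAM-type iteration on the defect R = [D, W] + P + PW, where P is the
truncated hopping plus the current V. A step solves [D, w] = -(R - diag R), replaces 1 + W by (1 +
W)(1 + w), subtracts diag R from P and adds the next dyadic shell of φ. By
`conjDefect_update_of_homological` the new defect consists of Rw, of terms linear in R that carry a
small factor, and of terms from the new shell. So the defect only decays geometrically, at the rate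
r = 2^(-σ) of the shells, and this is enough.

For the small divisors, (x mod 1) - (x - a mod 1) takes only two values, so its inverse has BV norm
O(1/‖a‖) (`hasBVBound_inv_fract_sub`) and dividing costs |k|^τ. At step n the weights carry a factor
exp(-ρ|k|) with ρ = 2^(-n); halving ρ absorbs the loss at the price 2^(τn). The increments of W are
therefore O(2^((τ-σ)n)), and σ > τ gives convergence with the decay ⟨k⟩^(-β) kept in the limit.

The required smallness of φ with decay β + σ = s - δ/2 comes from interpolating |φ_k| ≤ |k|^(-s)
with the small Sobolev norm (`IsPolynomialSymbol.interpolate`). The bound on V is read off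
afterwards from the diagonal of the solved equation, and it is linear in the norm
(`hasBVBound_correction`). Dirichlet's theorem forces τ ≥ 1, so the exponent in the claim is below 1
and C = 1 works. -/

/-! ### Periodic functions of bounded variation -/

/-- `f` has period `1` and `bvNorm f ≤ M`. -/
def HasBVBound (f : ℝ → ℝ) (M : ℝ) : Prop :=
  Function.Periodic f 1 ∧ bvNorm f ≤ ENNReal.ofReal M ∧ 0 ≤ M

theorem enorm_le_bvNorm (f : ℝ → ℝ) (x : ℝ) : ‖f x‖ₑ ≤ bvNorm f :=
  (le_iSup (fun x => ‖f x‖ₑ) x).trans le_self_add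

theorem bvNorm_add_le (f g : ℝ → ℝ) : bvNorm (fun x => f x + g x) ≤ bvNorm f + bvNorm g := by
  unfold bvNorm
  have h1 : (⨆ x : ℝ, ‖f x + g x‖ₑ) ≤ (⨆ x : ℝ, ‖f x‖ₑ) + ⨆ x : ℝ, ‖g x‖ₑ :=
    iSup_le fun x => (enorm_add_le _ _).trans
      (add_le_add (le_iSup (fun x => ‖f x‖ₑ) x) (le_iSup (fun x => ‖g x‖ₑ) x))
  have h2 : eVariationOn (fun x => f x + g x) (Set.Icc 0 1)
      ≤ eVariationOn f (Set.Icc 0 1) + eVariationOn g (Set.Icc 0 1) := by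
    refine iSup_le ?_
    rintro ⟨n, u, hu, hus⟩
    calc ∑ i ∈ Finset.range n, edist (f (u (i + 1)) + g (u (i + 1))) (f (u i) + g (u i))
        ≤ ∑ i ∈ Finset.range n, (edist (f (u (i + 1))) (f (u i)) +
            edist (g (u (i + 1))) (g (u i))) :=
          Finset.sum_le_sum fun i _ => edist_add_add_le _ _ _ _
      _ ≤ _ := by
          rw [Finset.sum_add_distrib]
          exact add_le_add (eVariationOn.sum_le hu hus) (eVariationOn.sum_le hu hus)
  calc _ ≤ _ := add_le_add h1 h2
    _ = _ := by ring

/-- The Leibniz bound Var(fg) ≤ sup|f| Var g + sup|g| Var f; expanding the product of the norms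
leaves Var f · Var g to spare. -/
theorem bvNorm_mul_le (f g : ℝ → ℝ) : bvNorm (fun x => f x * g x) ≤ bvNorm f * bvNorm g := by
  unfold bvNorm
  set F := ⨆ x : ℝ, ‖f x‖ₑ
  set G := ⨆ x : ℝ, ‖g x‖ₑ
  have hF : ∀ x, ‖f x‖ₑ ≤ F := fun x => le_iSup (fun x => ‖f x‖ₑ) x
  have hG : ∀ x, ‖g x‖ₑ ≤ G := fun x => le_iSup (fun x => ‖g x‖ₑ) x
  have h1 : (⨆ x : ℝ, ‖f x * g x‖ₑ) ≤ F * G :=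
    iSup_le fun x => by rw [enorm_mul]; exact mul_le_mul' (hF x) (hG x)
  have h2 := eVariationOn_fun_mul_le (s := Set.Icc (0 : ℝ) 1) (fun x _ => hF x) (fun x _ => hG x)
  calc _ ≤ _ := add_le_add h1 h2
    _ ≤ _ := by
      rw [add_mul, mul_add, mul_add]
      rw [show ∀ a b c : ℝ≥0∞, a + (b + c) = a + b + c from fun a b c => (add_assoc _ _ _).symm,
        mul_comm G]
      exact add_le_add le_rfl le_self_add

theorem bvNorm_neg (f : ℝ → ℝ) : bvNorm (fun x => - f x) = bvNorm f := by
  unfold bvNorm eVariationOn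
  simp only [enorm_neg, edist_neg_neg]

theorem bvNorm_const (c : ℝ) : bvNorm (fun _ : ℝ => c) = ‖c‖ₑ := by
  unfold bvNorm
  rw [eVariationOn.constant_on (by
    rintro _ ⟨x, -, rfl⟩ _ ⟨y, -, rfl⟩; rfl)]
  simp

theorem eVariationOn_comp_add_const (f : ℝ → ℝ) (a b c : ℝ) :
    eVariationOn (fun x => f (x + c)) (Set.Icc a b) = eVariationOn f (Set.Icc (a + c) (b + c)) := by
  have := eVariationOn.comp_eq_of_monotoneOn f (t := Set.Icc a b) (fun x => x + c)
    (fun x _ y _ h => by simpa using h)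
  rw [Set.image_add_const_Icc] at this
  exact this

theorem eVariationOn_Icc_add_Icc (f : ℝ → ℝ) {a b c : ℝ} (hab : a ≤ b) (hbc : b ≤ c) :
    eVariationOn f (Set.Icc a b) + eVariationOn f (Set.Icc b c) = eVariationOn f (Set.Icc a c) := by
  simpa using eVariationOn.Icc_add_Icc f (s := Set.univ) hab hbc (Set.mem_univ _)

/-- After reducing the shift to b in [0,1), the window [b, 1+b] is cut at 1 and the piece [1, 1+b]
is moved back by one period. -/
theorem Function.Periodic.bvNorm_comp_add {f : ℝ → ℝ} (hf : Function.Periodic f 1) (a : ℝ) :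
    bvNorm (fun x => f (x + a)) = bvNorm f := by
  have hfr : (fun x => f (x + a)) = fun x => f (x + Int.fract a) := by
    funext x
    have := hf.int_mul ⌊a⌋ (x + Int.fract a)
    rw [mul_one] at this
    rw [← this, add_assoc, Int.fract_add_floor]
  rw [hfr]
  set b := Int.fract a with hb
  have hb0 : 0 ≤ b := Int.fract_nonneg a
  have hb1 : b ≤ 1 := (Int.fract_lt_one a).le
  unfold bvNorm
  congr 1
  · exact (Equiv.addRight b).iSup_comp (g := fun x => ‖f x‖ₑ)
  · rw [eVariationOn_comp_add_const, ← eVariationOn_Icc_add_Icc f (b := 1) (by linarith)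
      (by linarith), ← eVariationOn_Icc_add_Icc f hb0 hb1, add_comm]
    congr 1
    · have := eVariationOn_comp_add_const f 0 b 1
      simp only [hf _] at this
      rw [show (fun x => f x) = f from rfl, zero_add] at this
      rw [this, add_comm b]
    · rw [zero_add]

/-- Both the supremum and the variation are lower semicontinuous under pointwise convergence. This
is what carries BV bounds to infinite sums and to the limit of the iteration. -/
theorem bvNorm_le_of_tendsto {ι : Type*} {l : Filter ι} [l.NeBot] {F : ι → ℝ → ℝ} {f : ℝ → ℝ}
    {M : ℝ≥0∞} (h : ∀ x, Tendsto (fun i => F i x) l (𝓝 (f x))) (hM : ∀ᶠ i in l, bvNorm (F i) ≤ M) :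
    bvNorm f ≤ M := by
  refine le_of_forall_lt fun c hc => ?_
  unfold bvNorm at hc
  -- The margin is split between the two summands; if one of them is 0 nothing lies strictly below
  -- it, hence the separate cases and the alternative `b = 0`.
  have key : ∃ a b : ℝ≥0∞, (∀ᶠ i in l, a ≤ ⨆ x, ‖F i x‖ₑ) ∧
      (∀ᶠ i in l, b < eVariationOn (F i) (Set.Icc 0 1) ∨ b = 0) ∧ c < a + b := by
    have hsup : ∀ a, (a < ⨆ x, ‖f x‖ₑ) → ∀ᶠ i in l, a ≤ ⨆ x, ‖F i x‖ₑ := by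
      intro a ha
      obtain ⟨x, hx⟩ := lt_iSup_iff.1 ha
      filter_upwards [((h x).enorm).eventually_const_lt hx] with i hi
      exact hi.le.trans (le_iSup (fun x => ‖F i x‖ₑ) x)
    rcases eq_or_ne (⨆ x, ‖f x‖ₑ) 0 with h0 | h0
    · rw [h0, zero_add] at hc
      obtain ⟨b, hb1, hb2⟩ := exists_between hc
      refine ⟨0, b, by simp, ?_, by simpa using hb1⟩
      filter_upwards [eVariationOn.lowerSemicontinuous_aux (fun x _ => h x) hb2] with i hi
      exact Or.inl hi
    rcases eq_or_ne (eVariationOn f (Set.Icc 0 1)) 0 with h1 | h1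
    · rw [h1, add_zero] at hc
      obtain ⟨a, ha1, ha2⟩ := exists_between hc
      exact ⟨a, 0, hsup a ha2, by simp, by simpa using ha1⟩
    obtain ⟨a, ha, b, hb, hab⟩ := ENNReal.exists_lt_add_of_lt_add hc h0 h1
    refine ⟨a, b, hsup a ha, ?_, hab⟩
    filter_upwards [eVariationOn.lowerSemicontinuous_aux (fun x _ => h x) hb] with i hi
    exact Or.inl hi
  obtain ⟨a, b, ha, hb, hab⟩ := key
  obtain ⟨i, hi1, hi2, hi3⟩ := (ha.and (hb.and hM)).exists
  refine hab.trans_le (le_trans (add_le_add hi1 ?_) hi3)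
  rcases hi2 with hi2 | hi2
  · exact hi2.le
  · simp [hi2]

namespace HasBVBound

variable {f g : ℝ → ℝ} {M N : ℝ}

theorem abs_le (hf : HasBVBound f M) (x : ℝ) : |f x| ≤ M := by
  have := (enorm_le_bvNorm f x).trans hf.2.1
  rwa [Real.enorm_eq_ofReal_abs, ENNReal.ofReal_le_ofReal_iff hf.2.2] at this

theorem mono (hf : HasBVBound f M) (h : M ≤ N) : HasBVBound f N :=
  ⟨hf.1, hf.2.1.trans (ENNReal.ofReal_le_ofReal h), hf.2.2.trans h⟩

theorem add (hf : HasBVBound f M) (hg : HasBVBound g N) :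
    HasBVBound (fun x => f x + g x) (M + N) := by
  refine ⟨hf.1.add hg.1, (bvNorm_add_le f g).trans ?_, add_nonneg hf.2.2 hg.2.2⟩
  rw [ENNReal.ofReal_add hf.2.2 hg.2.2]
  exact add_le_add hf.2.1 hg.2.1

theorem mul (hf : HasBVBound f M) (hg : HasBVBound g N) :
    HasBVBound (fun x => f x * g x) (M * N) := by
  refine ⟨hf.1.mul hg.1, (bvNorm_mul_le f g).trans ?_, mul_nonneg hf.2.2 hg.2.2⟩
  rw [ENNReal.ofReal_mul hf.2.2]
  exact mul_le_mul' hf.2.1 hg.2.1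

theorem neg (hf : HasBVBound f M) : HasBVBound (fun x => - f x) M :=
  ⟨fun x => by simp only [hf.1 x], (bvNorm_neg f).le.trans hf.2.1, hf.2.2⟩

theorem const (c : ℝ) : HasBVBound (fun _ => c) |c| :=
  ⟨fun _ => rfl, by rw [bvNorm_const, Real.enorm_eq_ofReal_abs], abs_nonneg c⟩

theorem zero (hM : 0 ≤ M) : HasBVBound (fun _ => 0) M :=
  (const 0).mono (by simpa using hM)

theorem sub (hf : HasBVBound f M) (hg : HasBVBound g N) :
    HasBVBound (fun x => f x - g x) (M + N) := by
  simpa only [sub_eq_add_neg] using hf.add hg.neg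

theorem comp_sub (hf : HasBVBound f M) (a : ℝ) : HasBVBound (fun x => f (x - a)) M := by
  simp only [sub_eq_add_neg]
  refine ⟨fun x => ?_, (hf.1.bvNorm_comp_add (-a)).le.trans hf.2.1, hf.2.2⟩
  beta_reduce
  rw [add_right_comm, hf.1]

theorem of_tendsto {ι : Type*} {l : Filter ι} [l.NeBot] {F : ι → ℝ → ℝ}
    (hF : ∀ i, HasBVBound (F i) M) (h : ∀ x, Tendsto (fun i => F i x) l (𝓝 (f x))) :
    HasBVBound f M := by
  obtain ⟨i⟩ : Nonempty ι := l.nonempty_of_neBot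
  refine ⟨fun x => ?_, bvNorm_le_of_tendsto h (.of_forall fun i => (hF i).2.1), (hF i).2.2⟩
  refine tendsto_nhds_unique (h _) ?_
  simpa only [(hF _).1 x] using h x

theorem sum {ι : Type*} {F : ι → ℝ → ℝ} {m : ι → ℝ} (hF : ∀ i, HasBVBound (F i) (m i))
    (s : Finset ι) : HasBVBound (fun x => ∑ i ∈ s, F i x) (∑ i ∈ s, m i) := by
  classical
  induction s using Finset.induction_on with
  | empty => simp [zero le_rfl]
  | insert a s ha ih => simpa [Finset.sum_insert ha] using (hF a).add ih

theorem tsum {ι : Type*} {F : ι → ℝ → ℝ} {m : ι → ℝ} (hF : ∀ i, HasBVBound (F i) (m i))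
    (hm : Summable m) : HasBVBound (fun x => ∑' i, F i x) (∑' i, m i) := by
  refine of_tendsto (l := atTop) (F := fun (s : Finset ι) x => ∑ i ∈ s, F i x)
    (fun s => (sum hF s).mono (hm.sum_le_tsum s fun i _ => (hF i).2.2)) fun x => ?_
  exact (Summable.of_norm_bounded hm fun i => (hF i).abs_le x).hasSum

end HasBVBound

/-! ### The fractional part and its difference quotients -/

/-- The supremum gives 1, and x and ⌊x⌋ contribute variation 1 each; the closed period includes the
jump at 1. -/
theorem hasBVBound_fract : HasBVBound Int.fract 3 := by
  refine ⟨Int.fract_periodic ℝ, ?_, by norm_num⟩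
  have h1 : (⨆ x : ℝ, ‖Int.fract x‖ₑ) ≤ 1 := iSup_le fun x => by
    rw [Real.enorm_eq_ofReal_abs, Int.abs_fract, ← ENNReal.ofReal_one]
    exact ENNReal.ofReal_le_ofReal (Int.fract_lt_one x).le
  have h2 : eVariationOn (Int.fract : ℝ → ℝ) (Set.Icc 0 1) ≤ 2 := by
    have hid : eVariationOn (id : ℝ → ℝ) (Set.Icc 0 1) ≤ 1 := by simp
    have hfl : eVariationOn (fun x : ℝ => (⌊x⌋ : ℝ)) (Set.Icc 0 1) ≤ 1 := by
      have hm : Monotone (fun x : ℝ => (⌊x⌋ : ℝ)) := fun x y h => by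
        simpa using Int.floor_mono h
      have := ((hm.monotoneOn Set.univ).eVariationOn_eq (Set.mem_univ 0) (Set.mem_univ 1)).le
      simpa using this
    refine le_trans (iSup_le ?_) (show (1 : ℝ≥0∞) + 1 ≤ 2 by norm_num)
    rintro ⟨n, u, hu, hus⟩
    calc ∑ i ∈ Finset.range n, edist (Int.fract (u (i + 1))) (Int.fract (u i))
        ≤ ∑ i ∈ Finset.range n, (edist (id (u (i + 1))) (id (u i)) +
            edist (⌊u (i + 1)⌋ : ℝ) (⌊u i⌋ : ℝ)) := by
          refine Finset.sum_le_sum fun i _ => ?_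
          rw [edist_eq_enorm_sub, edist_eq_enorm_sub, edist_eq_enorm_sub]
          rw [show Int.fract (u (i + 1)) - Int.fract (u i)
            = (id (u (i + 1)) - id (u i)) - ((⌊u (i + 1)⌋ : ℝ) - ⌊u i⌋) by
              simp only [Int.fract, id]; ring]
          exact enorm_sub_le
      _ ≤ _ := by
          rw [Finset.sum_add_distrib]
          exact add_le_add ((eVariationOn.sum_le (f := id) hu hus).trans hid)
            ((eVariationOn.sum_le (f := fun x : ℝ => (⌊x⌋ : ℝ)) hu hus).trans hfl)
  calc bvNorm (Int.fract : ℝ → ℝ) ≤ 1 + 2 := add_le_add h1 h2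
    _ = ENNReal.ofReal 3 := by norm_num

theorem distToInt_le_abs (a : ℝ) (n : ℤ) : distToInt a ≤ |a - n| :=
  ciInf_le ⟨0, by rintro _ ⟨k, rfl⟩; exact abs_nonneg _⟩ n

theorem distToInt_le_abs_fract_sub (a x : ℝ) :
    distToInt a ≤ |Int.fract x - Int.fract (x - a)| := by
  refine (distToInt_le_abs a (⌊x⌋ - ⌊x - a⌋)).trans (le_of_eq ?_)
  congr 1
  simp only [Int.fract]; push_cast; ring

/-- The difference takes only the values b and b - 1 with b = a mod 1, so its inverse is an affine
function of it. This gives a bound of order 1/ε, where the general estimate for 1/g would give 1/ε².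
The constant is 15 = 1 + 2(3 + 3 + 1). -/
theorem hasBVBound_inv_fract_sub {a ε : ℝ} (hε : 0 < ε) (ha : ε ≤ distToInt a) :
    HasBVBound (fun x => (Int.fract x - Int.fract (x - a))⁻¹) (15 / ε) := by
  set b := Int.fract a with hb
  have hb1 : b ≠ 0 := by
    intro h
    have := ha.trans (distToInt_le_abs a ⌊a⌋)
    rw [show a - ⌊a⌋ = Int.fract a from rfl, ← hb, h] at this
    simp at this; linarith
  have hbl : ε ≤ |b| := ha.trans (distToInt_le_abs a ⌊a⌋)
  have hbr : ε ≤ |b - 1| := by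
    refine (ha.trans (distToInt_le_abs a (⌊a⌋ + 1))).trans (le_of_eq ?_)
    rw [hb, Int.fract]; push_cast; congr 1; ring
  have hb2 : b - 1 ≠ 0 := by rw [← abs_pos]; linarith
  have key : ∀ x, (Int.fract x - Int.fract (x - a))⁻¹
      = b⁻¹ + (b⁻¹ - (b - 1)⁻¹) * ((Int.fract x - Int.fract (x - a)) - b) := by
    intro x
    have hz : ∃ z : ℤ, Int.fract x - Int.fract (x - a) = b + z :=
      ⟨⌊a⌋ - ⌊x⌋ + ⌊x - a⌋, by simp only [hb, Int.fract]; push_cast; ring⟩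
    obtain ⟨z, hz⟩ := hz
    have hz1 : z = 0 ∨ z = -1 := by
      have := Int.fract_nonneg x
      have := Int.fract_lt_one x
      have := Int.fract_nonneg (x - a)
      have := Int.fract_lt_one (x - a)
      have := Int.fract_nonneg a
      have := Int.fract_lt_one a
      have h1 : (z : ℝ) < 1 := by linarith
      have h2 : (-2 : ℝ) < z := by linarith
      have h1' : z < 1 := by exact_mod_cast h1
      have h2' : -2 < z := by exact_mod_cast h2
      omega
    rw [hz]
    rcases hz1 with rfl | rfl
    · simp
    · push_cast
      rw [← sub_eq_add_neg]; ring
  simp only [key]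
  have hc1 : |b⁻¹| ≤ 1 / ε := by
    rw [abs_inv, one_div]; exact inv_anti₀ hε hbl
  have hc2 : |b⁻¹ - (b - 1)⁻¹| ≤ 2 / ε := by
    refine (abs_sub _ _).trans ?_
    have : |(b - 1)⁻¹| ≤ 1 / ε := by rw [abs_inv, one_div]; exact inv_anti₀ hε hbr
    calc _ ≤ 1 / ε + 1 / ε := add_le_add hc1 this
      _ = 2 / ε := by ring
  have hb3 : |b| ≤ 1 := by
    rw [hb, Int.abs_fract]; exact (Int.fract_lt_one a).le
  refine (((HasBVBound.const b⁻¹).mono hc1).add (((HasBVBound.const _).mono hc2).mul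
    ((hasBVBound_fract.sub (hasBVBound_fract.comp_sub a)).sub
      ((HasBVBound.const b).mono hb3)))).mono (le_of_eq ?_)
  ring

/-! ### Weights on the lattice -/

section Weights

variable {d : ℕ}

theorem one_le_japanese (k : IntLat d) : 1 ≤ japanese k := le_max_left _ _

theorem japanese_pos (k : IntLat d) : 0 < japanese k := zero_lt_one.trans_le (one_le_japanese k)

theorem norm_le_japanese (k : IntLat d) : ‖k‖ ≤ japanese k := le_max_right _ _

theorem one_le_norm_of_ne_zero {k : IntLat d} (hk : k ≠ 0) : 1 ≤ ‖k‖ := by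
  obtain ⟨v, hv⟩ := Function.ne_iff.1 hk
  refine le_trans ?_ (norm_le_pi_norm k v)
  rw [Int.norm_eq_abs]
  exact_mod_cast Int.one_le_abs hv

theorem japanese_eq_norm {k : IntLat d} (hk : k ≠ 0) : japanese k = ‖k‖ :=
  max_eq_right (one_le_norm_of_ne_zero hk)

theorem japanese_zero : japanese (0 : IntLat d) = 1 := by simp [japanese]

/-- ℤ^d embeds isometrically for the sup norm in a lattice of ℝ^d, where the sum of ‖z‖^(-β) is
known to converge; the term k = 0 is irrelevant. -/
theorem summable_japanese_rpow {β : ℝ} (hβ : (d : ℝ) < β) :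
    Summable fun k : IntLat d => japanese k ^ (-β) := by
  have hβ0 : 0 < β := (Nat.cast_nonneg d).trans_lt hβ
  let L : Submodule ℤ (Fin d → ℝ) := Submodule.span ℤ (Set.range (Pi.basisFun ℝ (Fin d)))
  have hr : Module.finrank ℤ L = d := by
    rw [ZLattice.rank ℝ L]; simp
  have hs : Summable fun z : L => ‖z‖ ^ (-β) :=
    ZLattice.summable_norm_rpow L (-β) (by rw [hr]; linarith)
  have hmem : ∀ k : IntLat d, (fun v => (k v : ℝ)) ∈ L := by
    intro k
    have : (fun v => (k v : ℝ)) = ∑ v, k v • Pi.basisFun ℝ (Fin d) v := by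
      funext w
      simp [Finset.sum_apply, Pi.single_apply]
    rw [this]
    exact Submodule.sum_mem _ fun v _ => Submodule.smul_mem _ _ (Submodule.subset_span ⟨v, rfl⟩)
  let ι : IntLat d → L := fun k => ⟨fun v => (k v : ℝ), hmem k⟩
  have hι : Function.Injective ι := by
    intro k l h
    funext v
    exact Int.cast_injective (α := ℝ) (congrFun (congrArg Subtype.val h) v)
  have hn : ∀ k : IntLat d, ‖ι k‖ = ‖k‖ := by
    intro k
    rw [Submodule.coe_norm]
    simp only [ι, Pi.norm_def]
    congr 1
  have h1 := hs.comp_injective hι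
  refine Summable.of_norm_bounded_eventually (g := fun k => ‖ι k‖ ^ (-β)) h1 ?_
  have hfin : ({0} : Set (IntLat d))ᶜ ∈ (cofinite : Filter (IntLat d)) := by
    simp
  filter_upwards [hfin] with k hk
  rw [hn, japanese_eq_norm hk, Real.norm_of_nonneg (by positivity)]

/-- The weight `⟨k⟩^{-β} e^{-ρ|k|}`. -/
def latWeight (β ρ : ℝ) (k : IntLat d) : ℝ := japanese k ^ (-β) * Real.exp (-(ρ * ‖k‖))

theorem latWeight_pos (β ρ : ℝ) (k : IntLat d) : 0 < latWeight β ρ k :=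
  mul_pos (Real.rpow_pos_of_pos (japanese_pos k) _) (Real.exp_pos _)

theorem latWeight_zero_right (β : ℝ) (k : IntLat d) : latWeight β 0 k = japanese k ^ (-β) := by
  simp [latWeight]

theorem latWeight_at_zero (β ρ : ℝ) : latWeight β ρ (0 : IntLat d) = 1 := by
  simp [latWeight, japanese_zero]

theorem latWeight_anti (β : ℝ) {ρ ρ' : ℝ} (h : ρ ≤ ρ') (k : IntLat d) :
    latWeight β ρ' k ≤ latWeight β ρ k := by
  unfold latWeight
  have := japanese_pos k
  gcongr

theorem latWeight_le_one {β ρ : ℝ} (hβ : 0 ≤ β) (hρ : 0 ≤ ρ) (k : IntLat d) :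
    latWeight β ρ k ≤ 1 := by
  unfold latWeight
  refine mul_le_one₀ (Real.rpow_le_one_of_one_le_of_nonpos (one_le_japanese k) (by linarith))
    (Real.exp_pos _).le (Real.exp_le_one_iff.2 ?_)
  have := mul_nonneg hρ (norm_nonneg k)
  linarith

theorem latWeight_le_japanese {β ρ : ℝ} (hρ : 0 ≤ ρ) (k : IntLat d) :
    latWeight β ρ k ≤ japanese k ^ (-β) :=
  (latWeight_anti β hρ k).trans (latWeight_zero_right β k).le

theorem summable_latWeight {β ρ : ℝ} (hβ : (d : ℝ) < β) (hρ : 0 ≤ ρ) :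
    Summable fun k : IntLat d => latWeight β ρ k :=
  (summable_japanese_rpow hβ).of_nonneg_of_le (fun k => (latWeight_pos β ρ k).le)
    fun k => latWeight_le_japanese hρ k

variable (d) in
/-- The convolution constant of the weights `latWeight β ρ`. -/
def convConst (β : ℝ) : ℝ := 2 ^ β * (2 * ∑' k : IntLat d, japanese k ^ (-β))

theorem convConst_pos {β : ℝ} (hβ : (d : ℝ) < β) : 0 < convConst d β := by
  have : 0 < ∑' k : IntLat d, japanese k ^ (-β) :=
    (summable_japanese_rpow hβ).tsum_pos (fun k => (Real.rpow_pos_of_pos (japanese_pos k) _).le) 0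
      (Real.rpow_pos_of_pos (japanese_pos _) _)
  unfold convConst
  positivity

/-- The exponentials are handled by the triangle inequality, and the larger of ⟨l⟩ and ⟨k - l⟩ is at
least ⟨k⟩/2. Summed over l, this makes the symbols an algebra with a constant independent of ρ. -/
theorem latWeight_mul_le {β ρ : ℝ} (hβ : 0 ≤ β) (hρ : 0 ≤ ρ) (k l : IntLat d) :
    latWeight β ρ l * latWeight β ρ (k - l) ≤
      2 ^ β * latWeight β ρ k * (japanese l ^ (-β) + japanese (k - l) ^ (-β)) := by
  have hl := japanese_pos l
  have hkl := japanese_pos (k - l)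
  have hk := japanese_pos k
  have hn : ‖k‖ ≤ ‖l‖ + ‖k - l‖ := by
    simpa using norm_add_le l (k - l)
  have hexp : Real.exp (-(ρ * ‖l‖)) * Real.exp (-(ρ * ‖k - l‖)) ≤ Real.exp (-(ρ * ‖k‖)) := by
    rw [← Real.exp_add]
    apply Real.exp_le_exp.2
    nlinarith
  have hj : japanese k ≤ 2 * max (japanese l) (japanese (k - l)) := by
    have h1 := le_max_left (japanese l) (japanese (k - l))
    have h2 := le_max_right (japanese l) (japanese (k - l))
    refine max_le (by linarith [one_le_japanese l]) ?_
    linarith [norm_le_japanese l, norm_le_japanese (k - l)]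
  have hpow : japanese l ^ (-β) * japanese (k - l) ^ (-β) ≤
      2 ^ β * japanese k ^ (-β) * (japanese l ^ (-β) + japanese (k - l) ^ (-β)) := by
    have half : ∀ x : ℝ, 0 < x → japanese k ≤ 2 * x → x ^ (-β) ≤ 2 ^ β * japanese k ^ (-β) := by
      intro x hx h
      rw [Real.rpow_neg hx.le, Real.rpow_neg hk.le, ← div_eq_mul_inv, inv_eq_one_div,
        div_le_div_iff₀ (by positivity) (by positivity), one_mul,
        ← Real.mul_rpow (by norm_num) hx.le]
      exact Real.rpow_le_rpow hk.le h hβ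
    have p1 : 0 < japanese l ^ (-β) := by positivity
    have p2 : 0 < japanese (k - l) ^ (-β) := by positivity
    have p3 : 0 < 2 ^ β * japanese k ^ (-β) := by positivity
    rcases le_total (japanese l) (japanese (k - l)) with h | h
    · have := half _ hkl (by rwa [max_eq_right h] at hj)
      nlinarith
    · have := half _ hl (by rwa [max_eq_left h] at hj)
      nlinarith
  unfold latWeight
  calc _ = (japanese l ^ (-β) * japanese (k - l) ^ (-β)) *
        (Real.exp (-(ρ * ‖l‖)) * Real.exp (-(ρ * ‖k - l‖))) := by ring
    _ ≤ (2 ^ β * japanese k ^ (-β) * (japanese l ^ (-β) + japanese (k - l) ^ (-β))) *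
        Real.exp (-(ρ * ‖k‖)) := by
      apply mul_le_mul hpow hexp <;> positivity
    _ = _ := by ring

theorem summable_latWeight_mul {β ρ : ℝ} (hβ : (d : ℝ) < β) (hρ : 0 ≤ ρ) (k : IntLat d) :
    Summable fun l => latWeight β ρ l * latWeight β ρ (k - l) :=
  (summable_latWeight hβ hρ).of_nonneg_of_le
    (fun l => mul_nonneg (latWeight_pos β ρ l).le (latWeight_pos β ρ _).le) fun l =>
    mul_le_of_le_one_right (latWeight_pos β ρ l).le
      (latWeight_le_one ((Nat.cast_nonneg d).trans hβ.le) hρ _)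

theorem tsum_latWeight_mul_le {β ρ : ℝ} (hβ : (d : ℝ) < β) (hρ : 0 ≤ ρ) (k : IntLat d) :
    ∑' l, latWeight β ρ l * latWeight β ρ (k - l) ≤ convConst d β * latWeight β ρ k := by
  have hβ0 : 0 ≤ β := (Nat.cast_nonneg d).trans hβ.le
  have hs := summable_japanese_rpow hβ
  have hs' : Summable fun l : IntLat d => japanese (k - l) ^ (-β) :=
    (Equiv.subLeft k).summable_iff.2 hs
  have he : ∑' l : IntLat d, japanese (k - l) ^ (-β) = ∑' l : IntLat d, japanese l ^ (-β) :=
    (Equiv.subLeft k).tsum_eq fun l : IntLat d => japanese l ^ (-β)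
  refine ((summable_latWeight_mul hβ hρ k).tsum_le_tsum (latWeight_mul_le hβ0 hρ k)
    ((hs.add hs').mul_left _)).trans (le_of_eq ?_)
  rw [tsum_mul_left, hs.tsum_add hs', he]
  unfold convConst
  ring

/-- This is y ≤ exp y at y = ρx/τ, raised to the power τ. It trades the small-divisor loss |k|^τ for
a loss of exponential weight. -/
theorem rpow_mul_exp_neg_le {τ x ρ : ℝ} (hτ : 0 < τ) (hx : 0 ≤ x) (hρ : 0 < ρ) :
    x ^ τ * Real.exp (-(ρ * x)) ≤ τ ^ τ * (ρ⁻¹) ^ τ := by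
  rcases hx.eq_or_lt with rfl | hx
  · rw [Real.zero_rpow hτ.ne', zero_mul]; positivity
  rw [← Real.mul_rpow hτ.le (by positivity)]
  have h1 : Real.exp (-(ρ * x)) = (Real.exp (-(ρ * x / τ))) ^ τ := by
    rw [← Real.exp_mul]; congr 1; field_simp
  rw [h1, ← Real.mul_rpow hx.le (Real.exp_pos _).le]
  apply Real.rpow_le_rpow (by positivity) _ hτ.le
  have h2 : ρ * x / τ ≤ Real.exp (ρ * x / τ) := by
    linarith [Real.add_one_le_exp (ρ * x / τ)]
  rw [Real.exp_neg, ← div_eq_mul_inv, div_le_iff₀ (Real.exp_pos _)]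
  calc x = τ * ρ⁻¹ * (ρ * x / τ) := by field_simp
    _ ≤ _ := by gcongr

end Weights

/-! ### The crossed product algebra of symbols -/

section Symbols

variable {d : ℕ}

theorem phase_zero (ω : Fin d → ℝ) : phase ω 0 = 0 := by simp [phase]

theorem phase_add (ω : Fin d → ℝ) (k l : IntLat d) : phase ω (k + l) = phase ω k + phase ω l := by
  simp [phase, add_mul, Finset.sum_add_distrib]

theorem phase_sub (ω : Fin d → ℝ) (k l : IntLat d) : phase ω (k - l) = phase ω k - phase ω l := by
  simp [phase, sub_mul, Finset.sum_sub_distrib]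

/-- The symbol `A` stands for the matrix with entries `A (i - j) (i · ω)`. This says that its
diagonals are periodic and that `bvNorm (A k) ≤ M ⟨k⟩^{-β} e^{-ρ|k|}`. -/
def SymBound (β ρ M : ℝ) (A : IntLat d → ℝ → ℝ) : Prop :=
  ∀ k, HasBVBound (A k) (M * latWeight β ρ k)

/-- The symbol of a product of matrices. -/
def sconv (ω : Fin d → ℝ) (A B : IntLat d → ℝ → ℝ) : IntLat d → ℝ → ℝ :=
  fun k x => ∑' l, A l x * B (k - l) (x - phase ω l)

/-- The symbol of the commutator of a matrix with the diagonal matrix `(i · ω mod 1)`. -/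
def commFract (ω : Fin d → ℝ) (A : IntLat d → ℝ → ℝ) : IntLat d → ℝ → ℝ :=
  fun k x => (Int.fract x - Int.fract (x - phase ω k)) * A k x

/-- The diagonal part of a symbol. -/
def diagPart (A : IntLat d → ℝ → ℝ) : IntLat d → ℝ → ℝ :=
  fun k => if k = 0 then A 0 else 0

namespace SymBound

variable {β ρ ρ' M N : ℝ} {A B : IntLat d → ℝ → ℝ} {ω : Fin d → ℝ}

theorem nonneg (hA : SymBound β ρ M A) : 0 ≤ M := by
  simpa [latWeight_at_zero] using (hA 0).2.2

theorem abs_le (hA : SymBound β ρ M A) (k : IntLat d) (x : ℝ) : |A k x| ≤ M * latWeight β ρ k :=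
  (hA k).abs_le x

theorem mono (hA : SymBound β ρ M A) (h : M ≤ N) : SymBound β ρ N A := fun k =>
  (hA k).mono (mul_le_mul_of_nonneg_right h (latWeight_pos β ρ k).le)

theorem anti (hA : SymBound β ρ M A) (h : ρ' ≤ ρ) : SymBound β ρ' M A := fun k =>
  (hA k).mono (mul_le_mul_of_nonneg_left (latWeight_anti β h k) hA.nonneg)

theorem add (hA : SymBound β ρ M A) (hB : SymBound β ρ N B) : SymBound β ρ (M + N) (A + B) :=
  fun k => by
    rw [add_mul]
    exact (hA k).add (hB k)

theorem neg (hA : SymBound β ρ M A) : SymBound β ρ M (-A) := fun k => (hA k).neg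

theorem sub (hA : SymBound β ρ M A) (hB : SymBound β ρ N B) : SymBound β ρ (M + N) (A - B) := by
  rw [sub_eq_add_neg]
  exact hA.add hB.neg

theorem zero (hM : 0 ≤ M) : SymBound β ρ M (0 : IntLat d → ℝ → ℝ) := fun k =>
  HasBVBound.zero (mul_nonneg hM (latWeight_pos β ρ k).le)

theorem diagPart (hA : SymBound β ρ M A) : SymBound β ρ' M (diagPart A) := fun k => by
  unfold _root_.diagPart
  split_ifs with h
  · subst h
    simpa [latWeight_at_zero] using hA 0
  · exact HasBVBound.zero (mul_nonneg hA.nonneg (latWeight_pos β ρ' k).le)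

theorem sub_diagPart (hA : SymBound β ρ M A) : SymBound β ρ M (A - _root_.diagPart A) := fun k => by
  by_cases h : k = 0
  · subst h
    have : (A - _root_.diagPart A) 0 = fun _ => 0 := by
      funext x; simp [_root_.diagPart]
    rw [this]
    exact HasBVBound.zero (mul_nonneg hA.nonneg (latWeight_pos β ρ 0).le)
  · have : (A - _root_.diagPart A) k = A k := by
      funext x; simp [_root_.diagPart, h]
    rw [this]
    exact hA k

theorem commFract (hA : SymBound β ρ M A) : SymBound β ρ (6 * M) (commFract ω A) := fun k => by
  rw [mul_assoc]
  exact ((hasBVBound_fract.sub (hasBVBound_fract.comp_sub (phase ω k))).mono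
    (by norm_num)).mul (hA k)

theorem norm_term_le (hA : SymBound β ρ M A) (hB : SymBound β ρ N B) (k l : IntLat d) (x y : ℝ) :
    ‖A l x * B (k - l) y‖ ≤ M * N * (latWeight β ρ l * latWeight β ρ (k - l)) := by
  rw [norm_mul]
  calc _ ≤ (M * latWeight β ρ l) * (N * latWeight β ρ (k - l)) :=
        mul_le_mul (hA.abs_le l x) (hB.abs_le _ y) (abs_nonneg _)
          (mul_nonneg hA.nonneg (latWeight_pos β ρ l).le)
    _ = _ := by ring

theorem summable (hβ : (d : ℝ) < β) (hρ : 0 ≤ ρ) (hA : SymBound β ρ M A) (hB : SymBound β ρ N B)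
    (ω : Fin d → ℝ) (k : IntLat d) (x : ℝ) :
    Summable fun l => A l x * B (k - l) (x - phase ω l) :=
  Summable.of_norm_bounded ((summable_latWeight_mul hβ hρ k).mul_left (M * N))
    fun l => hA.norm_term_le hB k l _ _

theorem sconv (hβ : (d : ℝ) < β) (hρ : 0 ≤ ρ) (hA : SymBound β ρ M A) (hB : SymBound β ρ N B)
    (ω : Fin d → ℝ) : SymBound β ρ (convConst d β * M * N) (sconv ω A B) := fun k => by
  have hs := (summable_latWeight_mul hβ hρ k).mul_left (M * N)
  have h := HasBVBound.tsum (F := fun l x => A l x * B (k - l) (x - phase ω l))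
    (m := fun l => M * N * (latWeight β ρ l * latWeight β ρ (k - l))) (fun l => by
      have := (hA l).mul ((hB (k - l)).comp_sub (phase ω l))
      rwa [mul_mul_mul_comm] at this) hs
  refine h.mono ?_
  rw [tsum_mul_left]
  calc _ ≤ M * N * (convConst d β * latWeight β ρ k) :=
        mul_le_mul_of_nonneg_left (tsum_latWeight_mul_le hβ hρ k) (mul_nonneg hA.nonneg hB.nonneg)
    _ = _ := by ring

end SymBound

variable {β ρ L M N : ℝ} {A B C : IntLat d → ℝ → ℝ}

theorem sconv_add_left (hβ : (d : ℝ) < β) (hρ : 0 ≤ ρ) (hA : SymBound β ρ L A)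
    (hB : SymBound β ρ M B) (hC : SymBound β ρ N C) (ω : Fin d → ℝ) :
    sconv ω (A + B) C = sconv ω A C + sconv ω B C := by
  funext k x
  simp only [sconv, Pi.add_apply, add_mul]
  exact (hA.summable hβ hρ hC ω k x).tsum_add (hB.summable hβ hρ hC ω k x)

theorem sconv_add_right (hβ : (d : ℝ) < β) (hρ : 0 ≤ ρ) (hA : SymBound β ρ L A)
    (hB : SymBound β ρ M B) (hC : SymBound β ρ N C) (ω : Fin d → ℝ) :
    sconv ω A (B + C) = sconv ω A B + sconv ω A C := by
  funext k x
  simp only [sconv, Pi.add_apply, mul_add]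
  exact (hA.summable hβ hρ hB ω k x).tsum_add (hA.summable hβ hρ hC ω k x)

theorem sconv_neg_right (ω : Fin d → ℝ) (A B : IntLat d → ℝ → ℝ) :
    sconv ω A (-B) = - sconv ω A B := by
  funext k x
  simp only [sconv, Pi.neg_apply, mul_neg, tsum_neg]

theorem commFract_add (ω : Fin d → ℝ) (A B : IntLat d → ℝ → ℝ) :
    commFract ω (A + B) = commFract ω A + commFract ω B := by
  funext k x
  simp only [commFract, Pi.add_apply, mul_add]

theorem commFract_sconv (hβ : (d : ℝ) < β) (hρ : 0 ≤ ρ) (hA : SymBound β ρ M A)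
    (hB : SymBound β ρ N B) (ω : Fin d → ℝ) :
    commFract ω (sconv ω A B) = sconv ω (commFract ω A) B + sconv ω A (commFract ω B) := by
  funext k x
  have h1 := (hA.commFract (ω := ω)).summable hβ hρ hB ω k x
  have h2 := hA.summable hβ hρ (hB.commFract (ω := ω)) ω k x
  simp only [Pi.add_apply, sconv] at *
  rw [← h1.tsum_add h2, commFract, sconv, ← tsum_mul_left]
  refine tsum_congr fun l => ?_
  simp only [commFract, phase_sub]
  rw [show x - phase ω l - (phase ω k - phase ω l) = x - phase ω k by ring]
  ring

/-- Fubini for the double series over intermediate indices, dominated by a product of two summable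
weights. -/
theorem sconv_assoc (hβ : (d : ℝ) < β) (hρ : 0 ≤ ρ) (hA : SymBound β ρ L A)
    (hB : SymBound β ρ M B) (hC : SymBound β ρ N C) (ω : Fin d → ℝ) :
    sconv ω (sconv ω A B) C = sconv ω A (sconv ω B C) := by
  funext k x
  have hβ0 : 0 ≤ β := (Nat.cast_nonneg d).trans hβ.le
  let F : IntLat d → IntLat d → ℝ := fun l m =>
    A l x * B (m - l) (x - phase ω l) * C (k - m) (x - phase ω m)
  have hw := summable_latWeight (d := d) hβ hρ
  have hprod : Summable fun p : IntLat d × IntLat d =>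
      latWeight β ρ p.1 * latWeight β ρ p.2 :=
    hw.mul_of_nonneg hw (fun l => (latWeight_pos β ρ l).le) (fun l => (latWeight_pos β ρ l).le)
  have hinj : Function.Injective fun p : IntLat d × IntLat d => (p.1, p.2 - p.1) := by
    rintro ⟨a, b⟩ ⟨a', b'⟩ h
    simp only [Prod.mk.injEq] at h
    obtain ⟨rfl, h⟩ := h
    simpa using h
  have hF : Summable (Function.uncurry F) := by
    refine Summable.of_norm_bounded ((hprod.comp_injective hinj).mul_left (L * M * N)) ?_
    rintro ⟨l, m⟩
    simp only [Function.uncurry, F, Function.comp]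
    rw [norm_mul]
    have h1 := hA.norm_term_le hB m l x (x - phase ω l)
    have h2 : ‖C (k - m) (x - phase ω m)‖ ≤ N :=
      (hC.abs_le _ _).trans (mul_le_of_le_one_right hC.nonneg (latWeight_le_one hβ0 hρ _))
    calc _ ≤ (L * M * (latWeight β ρ l * latWeight β ρ (m - l))) * N :=
          mul_le_mul h1 h2 (norm_nonneg _) ((norm_nonneg _).trans h1)
      _ = _ := by ring
  calc sconv ω (sconv ω A B) C k x = ∑' m, ∑' l, F l m := by
        simp only [sconv, F]
        exact tsum_congr fun m => tsum_mul_right.symm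
    _ = ∑' l, ∑' m, F l m := hF.tsum_comm
    _ = _ := by
        simp only [sconv]
        refine tsum_congr fun l => ?_
        rw [← (Equiv.addRight l).tsum_eq, ← tsum_mul_left]
        refine tsum_congr fun n => ?_
        simp only [F, Equiv.coe_addRight, phase_add]
        rw [add_sub_cancel_right, show k - (n + l) = k - l - n by abel,
          show x - (phase ω n + phase ω l) = x - phase ω l - phase ω n by ring, mul_assoc]

end Symbols

/-! ### The homological equation and one step of the iteration -/

section Step

variable {d : ℕ}

theorem IsDiophantine.pos {τ γ : ℝ} {ω : Fin d → ℝ} (hω : IsDiophantine τ γ ω) (hγ : 0 < γ)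
    {k : IntLat d} (hk : k ≠ 0) :
    0 < γ / ‖k‖ ^ τ ∧ γ / ‖k‖ ^ τ ≤ distToInt (phase ω k) := by
  have := zero_lt_one.trans_le (one_le_norm_of_ne_zero hk)
  exact ⟨by positivity, hω k hk⟩

/-- The solution `w` of `[D, w] = -(R - diag R)` with `diag w = 0`. -/
def homSol (ω : Fin d → ℝ) (R : IntLat d → ℝ → ℝ) : IntLat d → ℝ → ℝ :=
  fun k => if k = 0 then 0 else
    fun x => -((Int.fract x - Int.fract (x - phase ω k))⁻¹ * R k x)

theorem commFract_homSol {τ γ : ℝ} {ω : Fin d → ℝ} (hω : IsDiophantine τ γ ω) (hγ : 0 < γ)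
    (R : IntLat d → ℝ → ℝ) : commFract ω (homSol ω R) = -(R - diagPart R) := by
  funext k x
  by_cases hk : k = 0
  · subst hk; simp [commFract, homSol, diagPart]
  · obtain ⟨h1, h2⟩ := hω.pos hγ hk
    have : Int.fract x - Int.fract (x - phase ω k) ≠ 0 :=
      abs_pos.1 ((h1.trans_le h2).trans_le (distToInt_le_abs_fract_sub _ x))
    simp only [commFract, homSol, diagPart, if_neg hk, Pi.neg_apply, Pi.sub_apply, sub_zero]
    field_simp

theorem SymBound.homSol {τ γ β ρ M : ℝ} {ω : Fin d → ℝ} {R : IntLat d → ℝ → ℝ}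
    (hR : SymBound β (2 * ρ) M R) (hω : IsDiophantine τ γ ω) (hγ : 0 < γ) (hτ : 0 < τ)
    (hρ : 0 < ρ) : SymBound β ρ (15 / γ * τ ^ τ * ρ⁻¹ ^ τ * M) (homSol ω R) := fun k => by
  have hM := hR.nonneg
  have hw := latWeight_pos β ρ k
  unfold _root_.homSol
  split_ifs with hk
  · exact HasBVBound.zero (by positivity)
  · obtain ⟨h1, h2⟩ := hω.pos hγ hk
    refine (((hasBVBound_inv_fract_sub h1 h2).mul (hR k)).neg).mono ?_
    have hn := zero_lt_one.trans_le (one_le_norm_of_ne_zero hk)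
    have hsplit : latWeight β (2 * ρ) k = latWeight β ρ k * Real.exp (-(ρ * ‖k‖)) := by
      unfold latWeight
      rw [mul_assoc (japanese k ^ (-β)), ← Real.exp_add]; congr 2; ring
    have hexp := rpow_mul_exp_neg_le hτ hn.le hρ
    calc 15 / (γ / ‖k‖ ^ τ) * (M * latWeight β (2 * ρ) k)
        = 15 / γ * M * latWeight β ρ k * (‖k‖ ^ τ * Real.exp (-(ρ * ‖k‖))) := by
          rw [hsplit]; field_simp
      _ ≤ 15 / γ * M * latWeight β ρ k * (τ ^ τ * ρ⁻¹ ^ τ) := by gcongr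
      _ = _ := by ring

/-- The symbol of `(D + P)(1 + W) - (1 + W) D`. -/
def conjDefect (ω : Fin d → ℝ) (W P : IntLat d → ℝ → ℝ) : IntLat d → ℝ → ℝ :=
  commFract ω W + P + sconv ω P W

/-- Expansion of the defect for the product (1 + W)(1 + w). The old P enters only through the old
defect, so the iteration never needs exponential weights on P. -/
theorem conjDefect_update {β M₁ M₂ M₃ M₄ : ℝ} {W P w p : IntLat d → ℝ → ℝ} (hβ : (d : ℝ) < β)
    (hW : SymBound β 0 M₁ W) (hP : SymBound β 0 M₂ P) (hw : SymBound β 0 M₃ w)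
    (hp : SymBound β 0 M₄ p) (ω : Fin d → ℝ) :
    conjDefect ω (W + w + sconv ω W w) (P + p) =
      conjDefect ω W P + commFract ω w + p + sconv ω (conjDefect ω W P) w
        + sconv ω W (commFract ω w) + sconv ω p (W + w + sconv ω W w) := by
  have hWw := hW.sconv hβ le_rfl hw ω
  have hPW := hP.sconv hβ le_rfl hW ω
  unfold conjDefect
  rw [commFract_add, commFract_add, commFract_sconv hβ le_rfl hW hw,
    sconv_add_left hβ le_rfl hP hp ((hW.add hw).add hWw),
    sconv_add_right hβ le_rfl hP (hW.add hw) hWw, sconv_add_right hβ le_rfl hP hW hw,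
    sconv_add_left hβ le_rfl ((hW.commFract (ω := ω)).add hP) hPW hw,
    sconv_add_left hβ le_rfl (hW.commFract (ω := ω)) hP hw, sconv_assoc hβ le_rfl hP hW hw]
  abel

/-- Here R + [D, w] = diag R, which the new correction -diag R cancels; every remaining term is a
product or comes from the new shell t. -/
theorem conjDefect_update_of_homological {β M₁ M₂ M₃ M₄ M₅ : ℝ} {W P w t : IntLat d → ℝ → ℝ}
    {ω : Fin d → ℝ} (hβ : (d : ℝ) < β) (hW : SymBound β 0 M₁ W) (hP : SymBound β 0 M₂ P)
    (hw : SymBound β 0 M₃ w) (ht : SymBound β 0 M₄ t) (hR : SymBound β 0 M₅ (conjDefect ω W P))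
    (hhom : commFract ω w = -(conjDefect ω W P - diagPart (conjDefect ω W P))) :
    conjDefect ω (W + w + sconv ω W w) (P + (t - diagPart (conjDefect ω W P))) =
      sconv ω (conjDefect ω W P) w - sconv ω W (conjDefect ω W P - diagPart (conjDefect ω W P))
        + t + sconv ω (t - diagPart (conjDefect ω W P)) (W + w + sconv ω W w) := by
  rw [conjDefect_update hβ hW hP hw (ht.sub hR.diagPart) ω, hhom, sconv_neg_right]
  abel

/-- The truncation of `φ` to `|k| ≤ 2 ^ n`, as a symbol. -/
def truncSym (φ : IntLat d → ℝ) (n : ℕ) : IntLat d → ℝ → ℝ :=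
  fun k _ => if ‖k‖ ≤ 2 ^ n then φ k else 0

theorem symBound_truncSym_zero {β σ ε : ℝ} {φ : IntLat d → ℝ} (hε : 0 ≤ ε) (hσ : 0 ≤ σ)
    (hφ : ∀ k, |φ k| ≤ ε * japanese k ^ (-(β + σ))) :
    SymBound β 1 (ε * Real.exp 1) (truncSym φ 0) := fun k => by
  have hj := japanese_pos k
  refine (HasBVBound.const (if ‖k‖ ≤ 2 ^ 0 then φ k else 0)).mono ?_
  split_ifs with h
  · rw [pow_zero] at h
    calc |φ k| ≤ ε * japanese k ^ (-(β + σ)) := hφ k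
      _ ≤ ε * (japanese k ^ (-β) * Real.exp (1 - ‖k‖)) := by
        gcongr
        rw [← mul_one (japanese k ^ (-(β + σ)))]
        gcongr
        · exact one_le_japanese k
        · linarith
        · exact Real.one_le_exp (by linarith)
      _ = _ := by
        rw [sub_eq_add_neg, Real.exp_add, latWeight, one_mul]; ring
  · rw [abs_zero]
    have := latWeight_pos β 1 k
    positivity

/-- On the shell 2^n < |k| ≤ 2^(n+1) one has ⟨k⟩^(-σ) ≤ 2^(-σn), while the exponential weight of
width 2^(-(n+1)) costs at most a factor e. -/
theorem symBound_truncSym_sub {β σ ε : ℝ} {φ : IntLat d → ℝ} (hε : 0 ≤ ε) (hσ : 0 ≤ σ)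
    (hφ : ∀ k, |φ k| ≤ ε * japanese k ^ (-(β + σ))) (n : ℕ) :
    SymBound β ((1 / 2) ^ (n + 1)) (ε * Real.exp 1 * ((2 : ℝ) ^ (-σ)) ^ n)
      (truncSym φ (n + 1) - truncSym φ n) := fun k => by
  have hj := japanese_pos k
  have hw := latWeight_pos β ((1 / 2) ^ (n + 1)) k
  have h0 : 0 ≤ ε * Real.exp 1 * ((2 : ℝ) ^ (-σ)) ^ n * latWeight β ((1 / 2) ^ (n + 1)) k := by
    positivity
  refine (HasBVBound.const ((if ‖k‖ ≤ 2 ^ (n + 1) then φ k else 0)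
    - (if ‖k‖ ≤ 2 ^ n then φ k else 0))).mono ?_
  have hmono : (2 : ℝ) ^ n ≤ 2 ^ (n + 1) := pow_le_pow_right₀ (by norm_num) (Nat.le_succ n)
  by_cases h1 : ‖k‖ ≤ 2 ^ n
  · rw [if_pos h1, if_pos (h1.trans hmono)]
    simpa using h0
  by_cases h2 : ‖k‖ ≤ 2 ^ (n + 1)
  · rw [if_neg h1, if_pos h2, sub_zero]
    have h3 : japanese k ^ (-σ) ≤ ((2 : ℝ) ^ (-σ)) ^ n := by
      rw [← Real.rpow_natCast, ← Real.rpow_mul (by norm_num), mul_comm, Real.rpow_mul (by norm_num),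
        Real.rpow_natCast]
      exact Real.rpow_le_rpow_of_nonpos (by positivity)
        ((not_le.1 h1).le.trans (norm_le_japanese k)) (by linarith)
    have h4 : (1 : ℝ) ≤ Real.exp (1 - (1 / 2) ^ (n + 1) * ‖k‖) := by
      apply Real.one_le_exp
      have : (1 / 2 : ℝ) ^ (n + 1) * ‖k‖ ≤ (1 / 2) ^ (n + 1) * 2 ^ (n + 1) := by gcongr
      rw [← mul_pow] at this
      norm_num at this
      linarith
    calc |φ k| ≤ ε * japanese k ^ (-(β + σ)) := hφ k
      _ = ε * (japanese k ^ (-β) * japanese k ^ (-σ)) * 1 := by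
        rw [← Real.rpow_add hj, neg_add, mul_one]
      _ ≤ ε * (japanese k ^ (-β) * ((2 : ℝ) ^ (-σ)) ^ n)
          * Real.exp (1 - (1 / 2) ^ (n + 1) * ‖k‖) := by gcongr
      _ = _ := by
        rw [sub_eq_add_neg, Real.exp_add, latWeight]; ring
  · rw [if_neg h1, if_neg h2]
    simpa using h0

end Step

/-! ### The iteration -/

section Iteration

variable {d : ℕ}

/-- One step of the iteration for the pair `(W, P)`. -/
def iterStep (ω : Fin d → ℝ) (t : IntLat d → ℝ → ℝ)
    (S : (IntLat d → ℝ → ℝ) × (IntLat d → ℝ → ℝ)) :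
    (IntLat d → ℝ → ℝ) × (IntLat d → ℝ → ℝ) :=
  (S.1 + homSol ω (conjDefect ω S.1 S.2) + sconv ω S.1 (homSol ω (conjDefect ω S.1 S.2)),
    S.2 + (t - diagPart (conjDefect ω S.1 S.2)))

/-- The approximate solutions of the conjugacy equation: `(conjIter ω φ n).1` is the conjugacy
(minus the identity), and `(conjIter ω φ n).2` the corrected perturbation. -/
def conjIter (ω : Fin d → ℝ) (φ : IntLat d → ℝ) :
    ℕ → (IntLat d → ℝ → ℝ) × (IntLat d → ℝ → ℝ)
  | 0 => (0, truncSym φ 0)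
  | n + 1 => iterStep ω (truncSym φ (n + 1) - truncSym φ n) (conjIter ω φ n)

theorem conjIter_snd_of_ne_zero (ω : Fin d → ℝ) (φ : IntLat d → ℝ) (n : ℕ) {k : IntLat d}
    (hk : k ≠ 0) : (conjIter ω φ n).2 k = truncSym φ n k := by
  induction n with
  | zero => rfl
  | succ n ih =>
    funext x
    have := congrFun ih x
    simp only [conjIter, iterStep, Pi.add_apply, Pi.sub_apply, diagPart, if_neg hk] at *
    rw [this]; simp

/-- The quantitative data of the iteration. -/
structure IterData (d : ℕ) (β τ σ γ ε η : ℝ) where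
  A : ℝ
  E : ℝ
  q : ℝ
  r : ℝ
  K : ℝ
  hβ : (d : ℝ) < β
  hτ : 0 < τ
  hσ : 0 ≤ σ
  hγ : 0 < γ
  hε : 0 ≤ ε
  hη : 0 ≤ η
  hA : 0 ≤ A
  hr : r = 2 ^ (-σ)
  hr1 : r < 1
  hq : q = r * 2 ^ τ
  hq1 : q < 1
  hE : E = ε * Real.exp 1
  hEA : E ≤ A
  hK : K = 15 / γ * τ ^ τ * 2 ^ τ
  small_increment : (1 + convConst d β * η) * (K * A) ≤ η * (1 - q)
  small_defect : convConst d β * A * (K * A) + 2 * convConst d β * η * A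
    + (convConst d β * η + 1) * E ≤ A * r

/-- The inductive estimates. -/
structure IterBound (β η A q r B : ℝ) (n : ℕ) (ω : Fin d → ℝ)
    (S : (IntLat d → ℝ → ℝ) × (IntLat d → ℝ → ℝ)) : Prop where
  fst : SymBound β ((1 / 2) ^ n) (η * (1 - q ^ n)) S.1
  snd : SymBound β 0 (B * (2 - r ^ n)) S.2
  defect : SymBound β ((1 / 2) ^ n) (A * r ^ n) (conjDefect ω S.1 S.2)

variable {β τ σ γ ε η : ℝ}

namespace IterData

variable (D : IterData d β τ σ γ ε η)
include D

theorem r_pos : 0 < D.r := by rw [D.hr]; positivity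

theorem q_pos : 0 < D.q := by
  rw [D.hq]
  have := D.r_pos
  positivity

theorem E_nonneg : 0 ≤ D.E := by
  rw [D.hE]
  have := D.hε
  positivity

theorem K_nonneg : 0 ≤ D.K := by
  rw [D.hK]
  have := D.hγ
  have := D.hτ
  positivity

/-- The bound for the perturbations. -/
def B : ℝ := (A D + E D) / (1 - r D)

theorem B_nonneg : 0 ≤ D.B :=
  div_nonneg (add_nonneg D.hA D.E_nonneg) (sub_nonneg.2 D.hr1.le)

theorem symBound_homSol {ω : Fin d → ℝ} (hω : IsDiophantine τ γ ω) {n : ℕ}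
    {S : (IntLat d → ℝ → ℝ) × (IntLat d → ℝ → ℝ)} (hS : IterBound β η D.A D.q D.r D.B n ω S) :
    SymBound β ((1 / 2) ^ (n + 1)) (D.K * D.A * D.q ^ n) (homSol ω (conjDefect ω S.1 S.2)) := by
  have hρ : (0 : ℝ) < (1 / 2) ^ (n + 1) := by positivity
  have hR := hS.defect
  rw [show ((1 : ℝ) / 2) ^ n = 2 * (1 / 2) ^ (n + 1) by rw [pow_succ]; ring] at hR
  refine (hR.homSol hω D.hγ D.hτ hρ).mono (le_of_eq ?_)
  have : (((1 : ℝ) / 2) ^ (n + 1))⁻¹ ^ τ = 2 ^ τ * ((2 : ℝ) ^ τ) ^ n := by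
    rw [one_div, inv_pow, inv_inv, ← pow_succ', ← Real.rpow_natCast, ← Real.rpow_natCast,
      ← Real.rpow_mul (by norm_num), ← Real.rpow_mul (by norm_num), mul_comm]
  rw [this, D.hK, D.hq, mul_pow]
  ring

theorem symBound_increment {ω : Fin d → ℝ} (hω : IsDiophantine τ γ ω) {n : ℕ}
    {S : (IntLat d → ℝ → ℝ) × (IntLat d → ℝ → ℝ)} (hS : IterBound β η D.A D.q D.r D.B n ω S) :
    SymBound β ((1 / 2) ^ (n + 1)) (η * (1 - D.q) * D.q ^ n)
      (homSol ω (conjDefect ω S.1 S.2) + sconv ω S.1 (homSol ω (conjDefect ω S.1 S.2))) := by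
  have hρ : (0 : ℝ) < (1 / 2) ^ (n + 1) := by positivity
  have hle : ((1 : ℝ) / 2) ^ (n + 1) ≤ (1 / 2) ^ n :=
    pow_le_pow_of_le_one (by norm_num) (by norm_num) (Nat.le_succ n)
  have hw := D.symBound_homSol hω hS
  have hq := D.q_pos
  have hη := D.hη
  have hqn : 0 < D.q ^ n := by positivity
  have hC := convConst_pos D.hβ
  have hKA := mul_nonneg D.K_nonneg D.hA
  have hW : SymBound β ((1 / 2) ^ (n + 1)) η S.1 :=
    (hS.fst.anti hle).mono (mul_le_of_le_one_right hη (by linarith))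
  refine (hw.add (hW.sconv D.hβ hρ.le hw ω)).mono ?_
  calc _ = (1 + convConst d β * η) * (D.K * D.A) * D.q ^ n := by ring
    _ ≤ _ := by
      have := D.small_increment
      gcongr

theorem iterBound_step {ω : Fin d → ℝ} (hω : IsDiophantine τ γ ω) {φ : IntLat d → ℝ}
    (hφ : ∀ k, |φ k| ≤ ε * japanese k ^ (-(β + σ))) {n : ℕ}
    {S : (IntLat d → ℝ → ℝ) × (IntLat d → ℝ → ℝ)} (hS : IterBound β η D.A D.q D.r D.B n ω S) :
    IterBound β η D.A D.q D.r D.B (n + 1) ω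
      (iterStep ω (truncSym φ (n + 1) - truncSym φ n) S) := by
  obtain ⟨W, P⟩ := S
  have hρ : (0 : ℝ) < (1 / 2) ^ (n + 1) := by positivity
  have hρn : (0 : ℝ) < (1 / 2) ^ n := by positivity
  have hle : ((1 : ℝ) / 2) ^ (n + 1) ≤ (1 / 2) ^ n :=
    pow_le_pow_of_le_one (by norm_num) (by norm_num) (Nat.le_succ n)
  have hq := D.q_pos
  have hr := D.r_pos
  have hη := D.hη
  have hA := D.hA
  have hE := D.E_nonneg
  have hK := D.K_nonneg
  have hC := convConst_pos D.hβ
  have hqn : 0 < D.q ^ n := by positivity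
  have hqn1 : D.q ^ n ≤ 1 := pow_le_one₀ hq.le D.hq1.le
  have hrn : 0 < D.r ^ n := by positivity
  have hw := D.symBound_homSol hω hS
  have hinc := D.symBound_increment hω hS
  have ht : SymBound β ((1 / 2) ^ (n + 1)) (D.E * D.r ^ n)
      (truncSym φ (n + 1) - truncSym φ n) := by
    rw [D.hE, D.hr]
    exact symBound_truncSym_sub D.hε D.hσ hφ n
  have hR := hS.defect
  have hP := hS.snd
  have hhom := commFract_homSol hω D.hγ (conjDefect ω W P)
  dsimp only at hw hinc hR hP
  set R := conjDefect ω W P with hRdef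
  set w := homSol ω R with hwdef
  set t := truncSym φ (n + 1) - truncSym φ n with htdef
  have hWn : SymBound β ((1 / 2) ^ (n + 1)) (η * (1 - D.q ^ n)) W := hS.fst.anti hle
  have hW : SymBound β ((1 / 2) ^ (n + 1)) η W :=
    hWn.mono (mul_le_of_le_one_right hη (by linarith))
  have hW' : SymBound β ((1 / 2) ^ (n + 1)) (η * (1 - D.q ^ (n + 1))) (W + w + sconv ω W w) := by
    rw [add_assoc]
    refine (hWn.add hinc).mono (le_of_eq ?_)
    rw [pow_succ]; ring
  have hW'η : SymBound β ((1 / 2) ^ (n + 1)) η (W + w + sconv ω W w) :=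
    hW'.mono (mul_le_of_le_one_right hη (by linarith [pow_pos hq (n + 1)]))
  have hR' := hR.anti hle
  refine ⟨hW', ?_, ?_⟩
  · refine (hP.add ((ht.anti hρ.le).sub (hR.diagPart (ρ' := 0)))).mono ?_
    -- `B` is chosen so that the increment (A + E) r^n of one step is exactly the growth of B(2 -
    -- r^n).
    have hB : D.B * (1 - D.r) = D.A + D.E := by
      unfold B
      have : 1 - D.r ≠ 0 := (sub_pos.2 D.hr1).ne'
      field_simp
    have : D.B * (2 - D.r ^ (n + 1)) = D.B * (2 - D.r ^ n) + D.B * (1 - D.r) * D.r ^ n := by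
      rw [pow_succ]; ring
    rw [this, hB]
    apply le_of_eq; ring
  · have hkey := conjDefect_update_of_homological D.hβ (hW.anti hρ.le) hP (hw.anti hρ.le)
      (ht.anti hρ.le) (hR.anti hρn.le) hhom
    change SymBound _ _ _ (conjDefect ω (W + w + sconv ω W w) (P + (t - diagPart R)))
    rw [hkey]
    refine ((((hR'.sconv D.hβ hρ.le hw ω).sub (hW.sconv D.hβ hρ.le hR'.sub_diagPart ω)).add
      ht).add ((ht.sub hR'.diagPart).sconv D.hβ hρ.le hW'η ω)).mono ?_
    -- Divided by r^n, the terms of the new defect add up to the left side of `small_defect`; in the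
    -- quadratic term q^n is simply bounded by 1.
    have h1 : convConst d β * (D.A * D.r ^ n) * (D.K * D.A * D.q ^ n)
        ≤ convConst d β * (D.A * D.r ^ n) * (D.K * D.A * 1) := by gcongr
    have h2 := mul_le_mul_of_nonneg_right D.small_defect hrn.le
    rw [pow_succ]
    nlinarith

theorem iterBound_conjIter {ω : Fin d → ℝ} (hω : IsDiophantine τ γ ω) {φ : IntLat d → ℝ}
    (hφ : ∀ k, |φ k| ≤ ε * japanese k ^ (-(β + σ))) (n : ℕ) :
    IterBound β η D.A D.q D.r D.B n ω (conjIter ω φ n) := by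
  induction n with
  | zero =>
    have h0 := symBound_truncSym_zero D.hε D.hσ hφ
    rw [← D.hE] at h0
    have hc : conjDefect ω 0 (truncSym φ 0) = truncSym φ 0 := by
      funext k x
      simp [conjDefect, commFract, sconv]
    refine ⟨?_, ?_, ?_⟩
    · simpa [conjIter] using SymBound.zero (β := β) (ρ := 1) (d := d) (le_refl (0 : ℝ))
    · refine (h0.anti zero_le_one).mono ?_
      rw [pow_zero, show (2 : ℝ) - 1 = 1 by norm_num, mul_one]
      unfold B
      rw [le_div_iff₀ (sub_pos.2 D.hr1)]
      have := D.E_nonneg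
      have := D.r_pos
      have := D.hA
      nlinarith
    · simp only [conjIter, hc, pow_zero, mul_one]
      exact h0.mono D.hEA
  | succ n ih => exact D.iterBound_step hω hφ ih

end IterData

theorem tendsto_sconv {M N : ℝ} {F G : ℕ → IntLat d → ℝ → ℝ} {A B : IntLat d → ℝ → ℝ}
    (hβ : (d : ℝ) < β) (hF : ∀ n, SymBound β 0 M (F n)) (hG : ∀ n, SymBound β 0 N (G n))
    (hFA : ∀ k x, Tendsto (fun n => F n k x) atTop (𝓝 (A k x)))
    (hGB : ∀ k x, Tendsto (fun n => G n k x) atTop (𝓝 (B k x))) (ω : Fin d → ℝ)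
    (k : IntLat d) (x : ℝ) :
    Tendsto (fun n => sconv ω (F n) (G n) k x) atTop (𝓝 (sconv ω A B k x)) := by
  refine tendsto_tsum_of_dominated_convergence
    ((summable_latWeight_mul hβ le_rfl k).mul_left (M * N)) (fun l => (hFA _ _).mul (hGB _ _)) ?_
  exact .of_forall fun n l => (hF n).norm_term_le (hG n) k l _ _

/-- The symbol of a diagonal correction plus an off-diagonal hopping. -/
def perturbSym (V : ℝ → ℝ) (φ : IntLat d → ℝ) : IntLat d → ℝ → ℝ :=
  fun k x => if k = 0 then V x else φ k

theorem IterData.exists_solution (D : IterData d β τ σ γ ε η) {ω : Fin d → ℝ}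
    (hω : IsDiophantine τ γ ω) {φ : IntLat d → ℝ}
    (hφ : ∀ k, |φ k| ≤ ε * japanese k ^ (-(β + σ))) :
    ∃ (V : ℝ → ℝ) (W : IntLat d → ℝ → ℝ) (M : ℝ), SymBound β 0 M (perturbSym V φ) ∧
      SymBound β 0 η W ∧ conjDefect ω W (perturbSym V φ) = 0 := by
  have hI := D.iterBound_conjIter hω hφ
  have hβ0 : 0 ≤ β := (Nat.cast_nonneg d).trans D.hβ.le
  have hη := D.hη
  have hW : ∀ n, SymBound β 0 η (conjIter ω φ n).1 := fun n =>
    ((hI n).fst.anti (by positivity)).mono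
      (mul_le_of_le_one_right hη (by linarith [pow_pos D.q_pos n]))
  have hP : ∀ n, SymBound β 0 (D.B * 2) (conjIter ω φ n).2 := fun n =>
    (hI n).snd.mono (mul_le_mul_of_nonneg_left (by linarith [pow_pos D.r_pos n]) D.B_nonneg)
  have hWlim : ∀ k x, ∃ y, Tendsto (fun n => (conjIter ω φ n).1 k x) atTop (𝓝 y) := by
    intro k x
    refine cauchySeq_tendsto_of_complete
      (cauchySeq_of_le_geometric D.q (η * (1 - D.q)) D.hq1 fun n => ?_)
    have h := (D.symBound_increment hω (hI n)).abs_le k x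
    rw [dist_comm, Real.dist_eq]
    simp only [conjIter, iterStep, Pi.add_apply] at h ⊢
    rw [add_assoc, add_sub_cancel_left]
    refine h.trans (mul_le_of_le_one_right ?_ (latWeight_le_one hβ0 (by positivity) k))
    have := D.q_pos
    have := sub_pos.2 D.hq1
    positivity
  have hVlim : ∀ x, ∃ y, Tendsto (fun n => (conjIter ω φ n).2 0 x) atTop (𝓝 y) := by
    intro x
    refine cauchySeq_tendsto_of_complete (cauchySeq_of_le_geometric D.r D.A D.hr1 fun n => ?_)
    have h := (hI n).defect.abs_le 0 x
    rw [latWeight_at_zero, mul_one] at h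
    rw [dist_comm, Real.dist_eq]
    have hn : ∀ m : ℕ, (0 : ℝ) ≤ 2 ^ m := fun m => by positivity
    simpa [conjIter, iterStep, diagPart, truncSym, hn] using h
  choose W hWt using hWlim
  choose V hVt using hVlim
  have hPt : ∀ k x, Tendsto (fun n => (conjIter ω φ n).2 k x) atTop (𝓝 (perturbSym V φ k x)) := by
    intro k x
    by_cases hk : k = 0
    · subst hk
      simpa [perturbSym] using hVt x
    -- Off the diagonal P is only a truncation of φ, hence eventually constant in n.
    · simp only [perturbSym, if_neg hk, conjIter_snd_of_ne_zero ω φ _ hk]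
      refine tendsto_const_nhds.congr' ?_
      filter_upwards [(tendsto_pow_atTop_atTop_of_one_lt (one_lt_two (α := ℝ))).eventually_ge_atTop
        ‖k‖] with n hn
      simp [truncSym, hn]
  refine ⟨V, W, D.B * 2, fun k => .of_tendsto (fun n => hP n k) (hPt k),
    fun k => .of_tendsto (fun n => hW n k) (hWt k), ?_⟩
  funext k x
  have h1 : Tendsto (fun n => conjDefect ω (conjIter ω φ n).1 (conjIter ω φ n).2 k x) atTop
      (𝓝 (conjDefect ω W (perturbSym V φ) k x)) :=
    (((hWt k x).const_mul _).add (hPt k x)).add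
      (tendsto_sconv D.hβ hP hW hPt hWt ω k x)
  have h2 : Tendsto (fun n => conjDefect ω (conjIter ω φ n).1 (conjIter ω φ n).2 k x) atTop
      (𝓝 0) := by
    have hg : Tendsto (fun n : ℕ => D.A * D.r ^ n) atTop (𝓝 0) := by
      simpa using (tendsto_pow_atTop_nhds_zero_of_lt_one D.r_pos.le D.hr1).const_mul D.A
    refine squeeze_zero_norm (fun n => ?_) hg
    exact ((hI n).defect.abs_le k x).trans (mul_le_of_le_one_right (hI n).defect.nonneg
      (latWeight_le_one hβ0 (by positivity) k))
  exact tendsto_nhds_unique h1 h2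

theorem exists_iterData (hβ : (d : ℝ) < β) (hτ : 0 < τ) (hτσ : τ < σ) (hγ : 0 < γ) (hη : 0 < η) :
    ∃ ε η' : ℝ, 0 < ε ∧ η' ≤ η ∧ Nonempty (IterData d β τ σ γ ε η') := by
  have hC := convConst_pos hβ
  set C := convConst d β
  obtain ⟨r, hr⟩ : ∃ r : ℝ, r = 2 ^ (-σ) := ⟨_, rfl⟩
  have hr0 : 0 < r := by rw [hr]; positivity
  have hr1 : r < 1 := by
    rw [hr]; exact Real.rpow_lt_one_of_one_lt_of_neg (by norm_num) (by linarith)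
  obtain ⟨q, hq⟩ : ∃ q : ℝ, q = r * 2 ^ τ := ⟨_, rfl⟩
  have hq1 : q < 1 := by
    rw [hq, hr, ← Real.rpow_add (by norm_num)]
    exact Real.rpow_lt_one_of_one_lt_of_neg (by norm_num) (by linarith)
  have hq1' := sub_pos.2 hq1
  obtain ⟨K, hK⟩ : ∃ K : ℝ, K = 15 / γ * τ ^ τ * 2 ^ τ := ⟨_, rfl⟩
  have hK0 : 0 < K := by rw [hK]; positivity
  -- The three terms of `small_defect` get a budget of A r/3 each: η' settles the linear one, the
  -- second bound on A the quadratic one, and E the shell. The first bound on A is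
  -- `small_increment`.
  obtain ⟨η', hη'⟩ : ∃ x : ℝ, x = min η (r / (6 * C)) := ⟨_, rfl⟩
  have hη0 : 0 < η' := by rw [hη']; positivity
  have hη2 : η' ≤ r / (6 * C) := by rw [hη']; exact min_le_right _ _
  obtain ⟨A, hA⟩ : ∃ x : ℝ, x = min (η' * (1 - q) / ((1 + C * η') * K)) (r / (3 * C * K)) :=
    ⟨_, rfl⟩
  have hA0 : 0 < A := by rw [hA]; positivity
  have hA1 : A ≤ η' * (1 - q) / ((1 + C * η') * K) := by rw [hA]; exact min_le_left _ _
  have hA2 : A ≤ r / (3 * C * K) := by rw [hA]; exact min_le_right _ _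
  rw [le_div_iff₀ (by positivity)] at hη2 hA1 hA2
  obtain ⟨E, hE⟩ : ∃ x : ℝ, x = A * r / (3 * (C * η' + 1)) := ⟨_, rfl⟩
  have hE0 : 0 < E := by rw [hE]; positivity
  have hE1 : E * (3 * (C * η' + 1)) = A * r := by rw [hE]; field_simp
  have he := Real.exp_pos 1
  refine ⟨E / Real.exp 1, η', by positivity, by rw [hη']; exact min_le_left _ _, ⟨?_⟩⟩
  refine
    { A := A, E := E, q := q, r := r, K := K, hβ := hβ, hτ := hτ, hσ := by linarith, hγ := hγ,
      hε := by positivity, hη := hη0.le, hA := hA0.le, hr := hr, hr1 := hr1, hq := hq, hq1 := hq1,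
      hE := by field_simp, hEA := ?_, hK := hK, small_increment := ?_, small_defect := ?_ }
  · have : 0 < C * η' := by positivity
    nlinarith
  · change (1 + C * η') * (K * A) ≤ _
    linarith
  · change C * A * (K * A) + 2 * C * η' * A + (C * η' + 1) * E ≤ A * r
    have h1 := mul_le_mul_of_nonneg_left hA2 hA0.le
    have h2 := mul_le_mul_of_nonneg_left hη2 hA0.le
    nlinarith

theorem exists_conjugacy (hβ : (d : ℝ) < β) (hτ : 0 < τ) (hτσ : τ < σ) (hγ : 0 < γ) (hη : 0 < η) :
    ∃ ε : ℝ, 0 < ε ∧ ∀ (ω : Fin d → ℝ) (φ : IntLat d → ℝ), IsDiophantine τ γ ω →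
      (∀ k, |φ k| ≤ ε * japanese k ^ (-(β + σ))) →
      ∃ (V : ℝ → ℝ) (W : IntLat d → ℝ → ℝ) (M : ℝ), SymBound β 0 M (perturbSym V φ) ∧
        SymBound β 0 η W ∧ conjDefect ω W (perturbSym V φ) = 0 := by
  obtain ⟨ε, η', hε, hη', ⟨D⟩⟩ := exists_iterData hβ hτ hτσ hγ hη
  refine ⟨ε, hε, fun ω φ hω hφ => ?_⟩
  obtain ⟨V, W, M, h1, h2, h3⟩ := D.exists_solution hω hφ
  exact ⟨V, W, M, h1, h2.mono hη', h3⟩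

end Iteration

/-! ### Operators on `ℓ²(ℤ^d)` -/

section Operators

variable {d : ℕ}

theorem norm_sq_eq_tsum (x : EllTwo d) : ‖x‖ ^ 2 = ∑' i, ‖x i‖ ^ 2 := by
  have := lp.norm_rpow_eq_tsum (p := 2) (by norm_num) x
  simpa using this

theorem summable_norm_sq (x : EllTwo d) : Summable fun i => ‖x i‖ ^ 2 := by
  have := (lp.memℓp x).summable (by norm_num)
  simpa using this

theorem exists_shift_mul (c : IntLat d → ℂ) {M : ℝ} (hc : ∀ i, ‖c i‖ ≤ M) (k : IntLat d) :
    ∃ T : EllTwo d →L[ℂ] EllTwo d, (∀ x i, T x i = c i * x (i - k)) ∧ ‖T‖ ≤ M := by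
  have hM : 0 ≤ M := (norm_nonneg _).trans (hc 0)
  have hb : ∀ (x : EllTwo d) (i : IntLat d),
      ‖c i * x (i - k)‖ ^ 2 ≤ M ^ 2 * ‖x (i - k)‖ ^ 2 := fun x i => by
    rw [norm_mul, mul_pow]
    have := hc i
    gcongr
  have hs : ∀ x : EllTwo d, Summable fun i => M ^ 2 * ‖x (i - k)‖ ^ 2 := fun x =>
    ((Equiv.subRight k).summable_iff.2 (summable_norm_sq x)).mul_left _
  have hs' : ∀ x : EllTwo d, Summable fun i => ‖c i * x (i - k)‖ ^ 2 := fun x =>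
    (hs x).of_nonneg_of_le (fun i => by positivity) (hb x)
  have hmem : ∀ x : EllTwo d, Memℓp (fun i => c i * x (i - k)) 2 := fun x =>
    memℓp_gen (by simpa using hs' x)
  let T : EllTwo d →ₗ[ℂ] EllTwo d :=
    { toFun := fun x => ⟨fun i => c i * x (i - k), hmem x⟩
      map_add' := fun x y => by ext i; exact mul_add _ _ _
      map_smul' := fun a x => by ext i; exact mul_left_comm _ _ _ }
  refine ⟨T.mkContinuous M fun x => ?_, fun x i => rfl, LinearMap.mkContinuous_norm_le _ hM _⟩
  refine abs_le_of_sq_le_sq' ?_ (by positivity) |>.2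
  rw [norm_sq_eq_tsum, mul_pow, norm_sq_eq_tsum x,
    ← (Equiv.subRight k).tsum_eq (fun i => ‖x i‖ ^ 2), ← tsum_mul_left]
  exact (hs' x).tsum_le_tsum (hb x) (hs x)

/-- The operator is the norm-convergent sum of its diagonals, each a weighted shift of norm at most
u k. -/
theorem exists_isOperatorOf (a : Matrix (IntLat d) (IntLat d) ℂ) {u : IntLat d → ℝ}
    (hu : Summable u) (ha : ∀ i j, ‖a i j‖ ≤ u (i - j)) :
    ∃ H : EllTwo d →L[ℂ] EllTwo d, IsOperatorOf H a ∧ ‖H‖ ≤ ∑' k, u k := by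
  choose T hT hTn using fun k =>
    exists_shift_mul (fun i => a i (i - k)) (M := u k) (fun i => by simpa using ha i (i - k)) k
  have hs : Summable T := Summable.of_norm_bounded hu hTn
  refine ⟨∑' k, T k, fun x i => ?_, tsum_of_norm_bounded hu.hasSum hTn⟩
  have h1 : HasSum (fun k => T k x i) ((∑' k, T k) x i) := by
    have h := (hs.hasSum.mapL (ContinuousLinearMap.apply ℂ (EllTwo d) x)).mapL
      (lp.evalCLM ℂ (fun _ : IntLat d => ℂ) 2 i)
    exact h
  rw [← (Equiv.subLeft i).hasSum_iff]
  convert h1 using 2 with k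
  simp [hT]

theorem IsOperatorOf.apply_single {H : EllTwo d →L[ℂ] EllTwo d}
    {a : Matrix (IntLat d) (IntLat d) ℂ} (hH : IsOperatorOf H a) (i k : IntLat d) :
    H (lp.single 2 k (1 : ℂ)) i = a i k := by
  refine (hH _ i).unique ?_
  convert hasSum_single k fun j hj => ?_ using 1
  · simp
  · rw [lp.single_apply_ne _ _ _ hj, mul_zero]

section Diagonalized

variable {H Q : EllTwo d →L[ℂ] EllTwo d} {D : IntLat d → ℂ}

theorem isUnit_of_norm_sub_one_lt (hQ : ‖Q - 1‖ < 1) : IsUnit Q := by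
  have := isUnit_one_sub_of_norm_lt_one (x := 1 - Q) (by rwa [norm_sub_rev])
  simpa using this

theorem hasSum_smul_single (x : EllTwo d) : HasSum (fun k => x k • lp.single 2 k (1 : ℂ)) x := by
  have h := lp.hasSum_single (by norm_num) x
  convert h using 2 with k
  rw [← lp.single_smul]; simp

theorem isCompleteFamily_of_isUnit (hQ : IsUnit Q) {c : IntLat d → ℂ} (hc : ∀ k, c k ≠ 0) :
    IsCompleteFamily fun k => c k • Q (lp.single 2 k (1 : ℂ)) := by
  obtain ⟨U, rfl⟩ := hQ
  unfold IsCompleteFamily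
  rw [eq_top_iff]
  intro x _
  set y := (↑U⁻¹ : EllTwo d →L[ℂ] EllTwo d) x with hy
  have hx : (U : EllTwo d →L[ℂ] EllTwo d) y = x := by
    exact DFunLike.congr_fun U.mul_inv x
  have hs := (hasSum_smul_single y).mapL (U : EllTwo d →L[ℂ] EllTwo d)
  rw [hx] at hs
  refine (Submodule.isClosed_topologicalClosure _).mem_of_tendsto hs (.of_forall fun s => ?_)
  refine Submodule.sum_mem _ fun k _ => Submodule.le_topologicalClosure _ ?_
  rw [map_smul]
  refine Submodule.smul_mem _ _ ?_
  have := Submodule.smul_mem _ (c k)⁻¹ (Submodule.subset_span (R := ℂ)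
    (Set.mem_range_self (f := fun k => c k • (U : EllTwo d →L[ℂ] EllTwo d) (lp.single 2 k (1 : ℂ))) k))
  rwa [smul_smul, inv_mul_cancel₀ (hc k), one_smul] at this

theorem hasPurePointSpectrum_of_isCompleteFamily {e : IntLat d → EllTwo d}
    (he : IsCompleteFamily e) (hH : ∀ k, H (e k) = D k • e k) : HasPurePointSpectrum H := by
  unfold HasPurePointSpectrum
  unfold IsCompleteFamily at he
  rw [eq_top_iff, ← he]
  refine Submodule.topologicalClosure_mono (Submodule.span_le.2 ?_)
  rintro _ ⟨k, rfl⟩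
  exact Submodule.mem_iSup_of_mem (D k) (Module.End.mem_eigenspace_iff.2 (hH k))

/-- For an eigenvector x, each coordinate of y = Q⁻¹x satisfies μ y_i = D_i y_i, and some y_i is
nonzero. The values of D need not be distinct. -/
theorem pointSpectrum_eq_range (hQ : IsUnit Q)
    (hH : ∀ k, H (Q (lp.single 2 k (1 : ℂ))) = D k • Q (lp.single 2 k (1 : ℂ))) :
    pointSpectrum H = Set.range D := by
  obtain ⟨U, rfl⟩ := hQ
  have hinj : ∀ x, (↑U⁻¹ : EllTwo d →L[ℂ] EllTwo d) ((U : EllTwo d →L[ℂ] EllTwo d) x) = x :=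
    fun x => DFunLike.congr_fun U.inv_mul x
  have hsurj : ∀ x, (U : EllTwo d →L[ℂ] EllTwo d) ((↑U⁻¹ : EllTwo d →L[ℂ] EllTwo d) x) = x :=
    fun x => DFunLike.congr_fun U.mul_inv x
  ext μ
  simp only [pointSpectrum, Set.mem_ofPred_eq, Set.mem_range]
  constructor
  · intro h
    obtain ⟨x, hx⟩ := h.exists_hasEigenvector
    have hx0 := hx.2
    have hHx : H x = μ • x := hx.apply_eq_smul
    set y := (↑U⁻¹ : EllTwo d →L[ℂ] EllTwo d) x with hy
    have hxy : x = (U : EllTwo d →L[ℂ] EllTwo d) y := (hsurj x).symm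
    have hy0 : y ≠ 0 := by
      rintro h0
      exact hx0 (by rw [hxy, h0, map_zero])
    obtain ⟨i, hi⟩ : ∃ i, y i ≠ 0 := by
      by_contra! hcon
      exact hy0 (lp.ext (funext hcon))
    refine ⟨i, ?_⟩
    have hs := (((hasSum_smul_single y).mapL (U : EllTwo d →L[ℂ] EllTwo d)).mapL H).mapL
      (↑U⁻¹ : EllTwo d →L[ℂ] EllTwo d)
    simp only [map_smul, hH, hinj] at hs
    rw [← hxy, hHx, map_smul, ← hy] at hs
    have hs' := hs.mapL (lp.evalCLM ℂ (fun _ : IntLat d => ℂ) 2 i)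
    have h1 : HasSum (fun k => y k * (D k * (lp.single 2 k (1 : ℂ) : EllTwo d) i)) (μ * y i) := hs'
    have h2 : HasSum (fun k => y k * (D k * (lp.single 2 k (1 : ℂ) : EllTwo d) i)) (y i * D i) := by
      convert hasSum_single i fun k hk => ?_ using 1
      · simp
      · rw [lp.single_apply_ne _ _ _ hk.symm]; simp
    have h3 := h1.unique h2
    rw [mul_comm] at h3
    exact (mul_left_cancel₀ hi h3).symm
  · rintro ⟨k, rfl⟩
    refine Module.End.hasEigenvalue_of_hasEigenvector
      (x := (U : EllTwo d →L[ℂ] EllTwo d) (lp.single 2 k (1 : ℂ))) ⟨?_, ?_⟩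
    · exact Module.End.mem_eigenspace_iff.2 (hH k)
    · intro h0
      have := hinj (lp.single 2 k (1 : ℂ))
      rw [h0, map_zero] at this
      have h1 := congrArg (fun z : EllTwo d => z k) this
      simp at h1

end Diagonalized

/-- The matrix with entries `A (i - j) (i · ω)`. -/
def symMatrix (ω : Fin d → ℝ) (A : IntLat d → ℝ → ℝ) : Matrix (IntLat d) (IntLat d) ℂ :=
  fun i j => (A (i - j) (phase ω i) : ℂ)

theorem SymBound.exists_isOperatorOf {β M : ℝ} {A : IntLat d → ℝ → ℝ} (hβ : (d : ℝ) < β)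
    (hA : SymBound β 0 M A) (ω : Fin d → ℝ) :
    ∃ H : EllTwo d →L[ℂ] EllTwo d, IsOperatorOf H (symMatrix ω A) ∧
      ‖H‖ ≤ M * ∑' k : IntLat d, japanese k ^ (-β) := by
  rw [← tsum_mul_left]
  refine _root_.exists_isOperatorOf _ ((summable_japanese_rpow hβ).mul_left M) fun i j => ?_
  rw [symMatrix, Complex.norm_real, ← latWeight_zero_right]
  exact hA.abs_le _ _

end Operators

/-! ### The eigenvectors -/

section Eigenvectors

variable {d : ℕ} {β M η : ℝ} {ω : Fin d → ℝ} {φ : IntLat d → ℝ} {V : ℝ → ℝ}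
  {W : IntLat d → ℝ → ℝ}

theorem perturbSym_zero (V : ℝ → ℝ) (φ : IntLat d → ℝ) : perturbSym V φ 0 = V := by
  funext x
  simp [perturbSym]

theorem perturbSym_of_ne_zero (V : ℝ → ℝ) (φ : IntLat d → ℝ) {k : IntLat d} (hk : k ≠ 0) :
    perturbSym V φ k = fun _ => φ k := by
  funext x
  simp [perturbSym, hk]

theorem symMatrix_perturbSym (hφ : φ 0 = 0) (V : ℝ → ℝ) :
    symMatrix ω (perturbSym V φ) =
      hopping φ + Matrix.diagonal (fun i : IntLat d => (V (phase ω i) : ℂ)) := by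
  ext i j
  by_cases h : i = j
  · subst h
    simp [symMatrix, perturbSym, hopping, hφ]
  · simp [symMatrix, perturbSym, hopping, sub_ne_zero.2 h, Matrix.diagonal_apply_ne _ h]

theorem SymBound.perturbSym_add {f : ℝ → ℝ} {N : ℝ} (h : SymBound β 0 M (perturbSym V φ))
    (hf : HasBVBound f N) : SymBound β 0 (N + M) (perturbSym (fun x => f x + V x) φ) := fun k => by
  by_cases hk : k = 0
  · subst hk
    have h0 := h 0
    rw [latWeight_at_zero, mul_one, perturbSym_zero] at *
    exact hf.add h0
  · have h0 := h k
    rw [perturbSym_of_ne_zero _ _ hk] at *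
    exact h0.mono (mul_le_mul_of_nonneg_right (by linarith [hf.2.2]) (latWeight_pos _ _ _).le)

/-- This is the entry (i, k) of (D + P)(1 + W) = (1 + W)D, with the convergence of the sum over j.
-/
theorem hasSum_conjugated_column (hβ : (d : ℝ) < β)
    (hP : SymBound β 0 M (perturbSym V φ)) (hW : SymBound β 0 η W)
    (hdef : conjDefect ω W (perturbSym V φ) = 0) (i k : IntLat d) :
    HasSum (fun j => perturbSym (fun x => Int.fract x + V x) φ (i - j) (phase ω i) *
        ((if j = k then 1 else 0) + W (j - k) (phase ω j)))
      (Int.fract (phase ω k) * ((if i = k then 1 else 0) + W (i - k) (phase ω i))) := by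
  rw [← (Equiv.subLeft i).hasSum_iff]
  set x := phase ω i with hx
  have hd := congrFun (congrFun hdef (i - k)) x
  simp only [conjDefect, commFract, Pi.add_apply, Pi.zero_apply] at hd
  have hxk : x - phase ω (i - k) = phase ω k := by rw [phase_sub]; ring
  rw [hxk] at hd
  have h1 : HasSum (fun m => perturbSym V φ m x * W (i - k - m) (x - phase ω m))
      (sconv ω (perturbSym V φ) W (i - k) x) := (hP.summable hβ le_rfl hW ω (i - k) x).hasSum
  have h2 : HasSum (fun m => perturbSym V φ m x * (if m = i - k then 1 else 0))
      (perturbSym V φ (i - k) x) := by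
    convert hasSum_single (i - k) fun m hm => ?_ using 1
    · simp
    · simp [hm]
  have h3 : HasSum (fun m : IntLat d => if m = 0 then
      Int.fract x * ((if i = k then 1 else 0) + W (i - k) x) else 0)
      (Int.fract x * ((if i = k then 1 else 0) + W (i - k) x)) := hasSum_ite_eq 0 _
  have h := (h1.add h2).add h3
  have hval : sconv ω (perturbSym V φ) W (i - k) x + perturbSym V φ (i - k) x +
      Int.fract x * ((if i = k then 1 else 0) + W (i - k) x) =
      Int.fract (phase ω k) * ((if i = k then 1 else 0) + W (i - k) x) := by
    by_cases hik : i = k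
    · subst hik
      simp only [if_true] at *
      rw [← hx] at *
      linarith
    · simp only [if_neg hik] at *
      linarith
  rw [hval] at h
  convert h using 2 with m
  have e1 : (if i - m = k then (1 : ℝ) else 0) = if m = i - k then 1 else 0 := by
    congr 1
    rw [sub_eq_iff_eq_add, eq_sub_iff_add_eq, add_comm m k]
    exact propext eq_comm
  simp only [Function.comp, Equiv.subLeft_apply, sub_sub_cancel]
  rw [e1, phase_sub, sub_right_comm i m k, ← hx]
  by_cases hm : m = 0
  · subst hm
    have e2 : (if (0 : IntLat d) = i - k then (1 : ℝ) else 0) = if i = k then 1 else 0 := by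
      congr 1
      rw [eq_comm (a := (0 : IntLat d)), sub_eq_zero]
    simp only [perturbSym, if_true, sub_zero, phase_zero, e2]
    ring
  · simp only [perturbSym, if_neg hm, add_zero]
    ring

theorem exists_eigenbasis (hβ : (d : ℝ) < β) (hφ : φ 0 = 0)
    (hP : SymBound β 0 M (perturbSym V φ)) (hW : SymBound β 0 η W)
    (hdef : conjDefect ω W (perturbSym V φ) = 0) (hη : η ≤ 1 / 2)
    (hηs : η * ∑' k : IntLat d, japanese k ^ (-β) ≤ 1 / 2) :
    ∃ H : EllTwo d →L[ℂ] EllTwo d,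
      IsOperatorOf H (hopping φ + Matrix.diagonal
        (fun i : IntLat d => ((Int.fract (phase ω i) + V (phase ω i) : ℝ) : ℂ))) ∧
      HasPurePointSpectrum H ∧
      (∃ e : IntLat d → EllTwo d,
        (∀ k, ‖e k‖ = 1 ∧ H (e k) = ((Int.fract (phase ω k) : ℝ) : ℂ) • e k) ∧
        IsCompleteFamily e ∧ ∀ i k : IntLat d, ‖e k i‖ ≤ 2 * japanese (i - k) ^ (-β)) ∧
      pointSpectrum H = Set.range (fun i : IntLat d => ((Int.fract (phase ω i) : ℝ) : ℂ)) := by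
  obtain ⟨H, hH, -⟩ := (hP.perturbSym_add hasBVBound_fract).exists_isOperatorOf hβ ω
  obtain ⟨T, hT, hTn⟩ := hW.exists_isOperatorOf hβ ω
  set Q : EllTwo d →L[ℂ] EllTwo d := 1 + T with hQdef
  have hQ : IsUnit Q := isUnit_of_norm_sub_one_lt (by
    rw [hQdef, add_sub_cancel_left]
    linarith)
  have hQe : ∀ j k : IntLat d, Q (lp.single 2 k (1 : ℂ)) j =
      (((if j = k then 1 else 0) + W (j - k) (phase ω j) : ℝ) : ℂ) := by
    intro j k
    have h1 : Q (lp.single 2 k (1 : ℂ)) j =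
        (lp.single 2 k (1 : ℂ) : EllTwo d) j + T (lp.single 2 k (1 : ℂ)) j := rfl
    rw [h1, hT.apply_single]
    by_cases hjk : j = k
    · subst hjk
      simp [symMatrix]
    · rw [lp.single_apply_ne _ _ _ hjk]
      simp [symMatrix, hjk]
  have hcol : ∀ k, H (Q (lp.single 2 k (1 : ℂ))) =
      ((Int.fract (phase ω k) : ℝ) : ℂ) • Q (lp.single 2 k (1 : ℂ)) := by
    intro k
    refine lp.ext (funext fun i => ?_)
    refine (hH _ i).unique ?_
    have h1 : (((Int.fract (phase ω k) : ℝ) : ℂ) • Q (lp.single 2 k (1 : ℂ))) i =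
        ((Int.fract (phase ω k) : ℝ) : ℂ) * Q (lp.single 2 k (1 : ℂ)) i := rfl
    rw [h1, hQe, ← Complex.ofReal_mul]
    simp only [hQe, symMatrix, ← Complex.ofReal_mul]
    exact Complex.hasSum_ofReal.2 (hasSum_conjugated_column hβ hP hW hdef i k)
  have hWle : ∀ j k : IntLat d, |W (j - k) (phase ω j)| ≤ η * japanese (j - k) ^ (-β) :=
    fun j k => by
      rw [← latWeight_zero_right]
      exact hW.abs_le _ _
  -- The diagonal entry 1 + W_0 is at least 1/2, so normalizing the column costs at most the factor
  -- 2 of the decay estimate.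
  have hnorm : ∀ k, 1 / 2 ≤ ‖Q (lp.single 2 k (1 : ℂ))‖ := by
    intro k
    refine le_trans ?_ (lp.norm_apply_le_norm (by norm_num) _ k)
    rw [hQe, Complex.norm_real, if_pos rfl]
    have h1 := hWle k k
    rw [sub_self, japanese_zero, Real.one_rpow, mul_one] at h1
    rw [sub_self]
    have h2 := (abs_le.1 h1).1
    exact le_trans (by linarith) (le_abs_self _)
  have hpos : ∀ k, 0 < ‖Q (lp.single 2 k (1 : ℂ))‖ := fun k => by linarith [hnorm k]
  set c : IntLat d → ℂ := fun k => ((‖Q (lp.single 2 k (1 : ℂ))‖⁻¹ : ℝ) : ℂ) with hc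
  have hcn : ∀ k, ‖c k‖ = ‖Q (lp.single 2 k (1 : ℂ))‖⁻¹ := fun k => by
    rw [hc, Complex.norm_real, Real.norm_of_nonneg (inv_nonneg.2 (hpos k).le)]
  have hc0 : ∀ k, c k ≠ 0 := fun k => by
    rw [← norm_pos_iff, hcn]
    exact inv_pos.2 (hpos k)
  have hcomp := isCompleteFamily_of_isUnit hQ hc0
  have heig : ∀ k, H (c k • Q (lp.single 2 k (1 : ℂ))) =
      ((Int.fract (phase ω k) : ℝ) : ℂ) • c k • Q (lp.single 2 k (1 : ℂ)) := fun k => by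
    rw [map_smul, hcol, smul_comm]
  have hn1 : ∀ k, ‖c k • Q (lp.single 2 k (1 : ℂ))‖ = 1 := fun k => by
    rw [norm_smul, hcn, inv_mul_cancel₀ (hpos k).ne']
  refine ⟨H, ?_, hasPurePointSpectrum_of_isCompleteFamily hcomp heig,
    ⟨_, fun k => ⟨hn1 k, heig k⟩, hcomp, fun i k => ?_⟩, pointSpectrum_eq_range hQ hcol⟩
  · rwa [symMatrix_perturbSym hφ] at hH
  · by_cases hik : i = k
    · subst hik
      refine (lp.norm_apply_le_norm (by norm_num) _ i).trans ?_
      rw [hn1, sub_self, japanese_zero, Real.one_rpow]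
      norm_num
    · have h1 : (c k • Q (lp.single 2 k (1 : ℂ))) i = c k * Q (lp.single 2 k (1 : ℂ)) i := rfl
      rw [h1, norm_mul, hcn, hQe, if_neg hik, zero_add, Complex.norm_real]
      have hj := Real.rpow_pos_of_pos (japanese_pos (i - k)) (-β)
      have h2 : ‖Q (lp.single 2 k (1 : ℂ))‖⁻¹ ≤ 2 := by
        rw [inv_le_comm₀ (hpos k) (by norm_num)]
        linarith [hnorm k]
      have h3 : |W (i - k) (phase ω i)| ≤ japanese (i - k) ^ (-β) :=
        (hWle i k).trans (mul_le_of_le_one_left hj.le (by linarith))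
      exact mul_le_mul h2 h3 (norm_nonneg _) (by norm_num)

/-- The diagonal correction is bounded linearly by the hopping. -/
theorem hasBVBound_correction {ε : ℝ} (hβ : (d : ℝ) < β) (hφ : φ 0 = 0)
    (hφε : ∀ k, |φ k| ≤ ε)
    (hP : SymBound β 0 M (perturbSym V φ)) (hW : SymBound β 0 η W)
    (hdef : conjDefect ω W (perturbSym V φ) = 0) (hη : η ≤ 1 / 2)
    (hηs : η * ∑' k : IntLat d, japanese k ^ (-β) ≤ 1 / 2) : HasBVBound V ε := by
  have hε : 0 ≤ ε := (abs_nonneg _).trans (hφε 0)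
  have hη0 := hW.nonneg
  have hs : Summable fun l : IntLat d => japanese (-l) ^ (-β) :=
    (Equiv.neg (IntLat d)).summable_iff.2 (summable_japanese_rpow hβ)
  have hse : ∑' l : IntLat d, japanese (-l) ^ (-β) = ∑' l : IntLat d, japanese l ^ (-β) :=
    (Equiv.neg (IntLat d)).tsum_eq fun l : IntLat d => japanese l ^ (-β)
  have hG : HasBVBound (fun x => ∑' l, φ l * W (0 - l) (x - phase ω l)) (ε / 2) := by
    refine (HasBVBound.tsum (m := fun l => ε * (η * japanese (-l) ^ (-β))) (fun l => ?_)
      ((hs.mul_left η).mul_left ε)).mono ?_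
    · have h := hW (0 - l)
      rw [latWeight_zero_right, zero_sub] at h
      have := ((HasBVBound.const (φ l)).mono (hφε l)).mul (h.comp_sub (phase ω l))
      simpa using this
    · rw [tsum_mul_left, tsum_mul_left, hse]
      nlinarith
  have hV : HasBVBound V M := by
    have := hP 0
    rwa [latWeight_at_zero, mul_one, perturbSym_zero] at this
  have hW0 : HasBVBound (W 0) η := by
    have := hW 0
    rwa [latWeight_at_zero, mul_one] at this
  -- On the zero diagonal the commutator vanishes, leaving V + (PW)_0 = 0; the term l = 0 is V W_0
  -- and all others involve φ alone.
  have heq : ∀ x, V x = -(V x * W 0 x + ∑' l, φ l * W (0 - l) (x - phase ω l)) := by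
    intro x
    have hd := congrFun (congrFun hdef 0) x
    simp only [conjDefect, commFract, Pi.add_apply, Pi.zero_apply, phase_zero, sub_zero, sub_self,
      zero_mul, zero_add] at hd
    have hsum := (hP.summable hβ le_rfl hW ω 0 x).hasSum
    have hsingle : HasSum (fun l : IntLat d => if l = 0 then V x * W 0 x else 0) (V x * W 0 x) :=
      hasSum_ite_eq 0 _
    have hsub := (hsum.sub hsingle).tsum_eq
    have hterm : ∀ l : IntLat d, perturbSym V φ l x * W (0 - l) (x - phase ω l)
        - (if l = 0 then V x * W 0 x else 0) = φ l * W (0 - l) (x - phase ω l) := by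
      intro l
      by_cases hl : l = 0
      · subst hl
        simp [perturbSym, hφ, phase_zero]
      · simp [perturbSym, hl]
    simp only [hterm] at hsub
    rw [hsub]
    have : sconv ω (perturbSym V φ) W 0 x
        = ∑' l, perturbSym V φ l x * W (0 - l) (x - phase ω l) := rfl
    simp only [perturbSym, if_true] at hd
    rw [← this]
    have h0 : sconv ω (perturbSym V φ) W 0 x = sconv ω (fun k x => if k = 0 then V x else φ k) W 0 x :=
      rfl
    rw [h0]
    linarith
  -- The a priori finiteness allows m to be absorbed: m ≤ mη + ε/2 with η ≤ 1/2 gives m ≤ ε,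
  -- whatever the size of M.
  have hfin : bvNorm V ≠ ⊤ := (hV.2.1.trans_lt ENNReal.ofReal_lt_top).ne
  set m := (bvNorm V).toReal with hm
  have hVm : HasBVBound V m := ⟨hV.1, by rw [hm, ENNReal.ofReal_toReal hfin], ENNReal.toReal_nonneg⟩
  have h := ((hVm.mul hW0).add hG).neg
  have hle : bvNorm V ≤ ENNReal.ofReal (m * η + ε / 2) := by
    rw [show V = fun x => -(V x * W 0 x + ∑' l, φ l * W (0 - l) (x - phase ω l)) from
      funext heq]
    exact h.2.1
  have hmle : m ≤ m * η + ε / 2 := ENNReal.toReal_le_of_le_ofReal h.2.2 hle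
  have hm0 : 0 ≤ m := hVm.2.2
  exact hVm.mono (by nlinarith)

end Eigenvectors

/-! ### The hypotheses -/

section Hypotheses

variable {d : ℕ}

theorem enorm_le_seqNorm (ω : Fin d → ℝ) (a : IntLat d → ℂ) : ‖a 0‖ₑ ≤ seqNorm ω a := by
  refine le_iInf₂ fun f hf => ?_
  rw [← hf.2 0]
  exact (le_iSup (fun x => ‖f x‖ₑ) _).trans le_self_add

/-- One term of the series is kept; its weight is at least 1 and the sequence norm dominates the
value at 0. -/
theorem ofReal_abs_le_sobolevNorm (ω : Fin d → ℝ) {r : ℝ} (hr : 0 ≤ r) (φ : IntLat d → ℝ)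
    (k : IntLat d) : ENNReal.ofReal |φ k| ≤ sobolevNorm ω r (hopping φ) := by
  have h1 : ENNReal.ofReal |φ k| ≤ seqNorm ω (kDiagonal (hopping φ) k) := by
    refine le_trans (le_of_eq ?_) (enorm_le_seqNorm ω _)
    rw [← ofReal_norm]
    simp [kDiagonal, hopping]
  have h2 : (1 : ℝ≥0∞) ≤ ENNReal.ofReal (japanese k ^ (2 * r)) := by
    rw [ENNReal.one_le_ofReal]
    exact Real.one_le_rpow (one_le_japanese k) (by linarith)
  have h3 : ENNReal.ofReal |φ k| ^ 2 ≤ ∑' k : IntLat d,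
      seqNorm ω (kDiagonal (hopping φ) k) ^ 2 * ENNReal.ofReal (japanese k ^ (2 * r)) :=
    calc ENNReal.ofReal |φ k| ^ 2 = ENNReal.ofReal |φ k| ^ 2 * 1 := (mul_one _).symm
      _ ≤ seqNorm ω (kDiagonal (hopping φ) k) ^ 2 * ENNReal.ofReal (japanese k ^ (2 * r)) := by
        gcongr
      _ ≤ _ := ENNReal.le_tsum (f := fun k : IntLat d => seqNorm ω (kDiagonal (hopping φ) k) ^ 2 *
        ENNReal.ofReal (japanese k ^ (2 * r))) k
  have h4 := ENNReal.rpow_le_rpow h3 (show (0 : ℝ) ≤ 1 / 2 by norm_num)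
  rw [← ENNReal.rpow_natCast, ← ENNReal.rpow_mul] at h4
  norm_num at h4
  unfold sobolevNorm
  convert h4 using 2

/-- By Dirichlet's theorem, the Diophantine exponent is at least `1`. -/
theorem IsDiophantine.one_le_exponent {τ γ : ℝ} {ω : Fin d → ℝ} (hω : IsDiophantine τ γ ω)
    (hd : 1 ≤ d) (hγ : 0 < γ) (hτ : 0 < τ) : 1 ≤ τ := by
  by_contra! hlt
  let v : Fin d := ⟨0, hd⟩
  -- Dirichlet approximation of a single frequency gives 0 < k ≤ n with ‖kω_v‖ ≤ 1/(n+1), against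
  -- the lower bound γ k^(-τ); for τ < 1 the right side tends to 0.
  have key : ∀ n : ℕ, 0 < n → γ ≤ (n : ℝ) ^ (τ - 1) := by
    intro n hn
    obtain ⟨j, k, hk0, hkn, hjk⟩ := Real.exists_int_int_abs_mul_sub_le (ω v) hn
    have hk : (Pi.single v k : IntLat d) ≠ 0 := by
      simpa using hk0.ne'
    have h1 := hω _ hk
    have hnorm : ‖(Pi.single v k : IntLat d)‖ = k := by
      rw [Pi.norm_single, Int.norm_eq_abs, abs_of_pos (by exact_mod_cast hk0)]
    have hphase : phase ω (Pi.single v k) = k * ω v := by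
      unfold phase
      rw [Finset.sum_eq_single v]
      · simp
      · intro b _ hb
        simp [Pi.single_eq_of_ne hb]
      · simp
    rw [hnorm, hphase] at h1
    have h2 := h1.trans ((distToInt_le_abs _ j).trans hjk)
    have hk0' : (0 : ℝ) < k := by exact_mod_cast hk0
    have hn0 : (0 : ℝ) < n := by exact_mod_cast hn
    rw [div_le_iff₀ (by positivity)] at h2
    calc γ ≤ 1 / (n + 1) * (k : ℝ) ^ τ := h2
      _ ≤ 1 / n * (n : ℝ) ^ τ := by
        gcongr
        · linarith
        · exact_mod_cast hkn
      _ = _ := by rw [Real.rpow_sub hn0, Real.rpow_one]; field_simp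
  have hlim : Tendsto (fun n : ℕ => (n : ℝ) ^ (τ - 1)) atTop (𝓝 0) := by
    have := (tendsto_rpow_neg_atTop (y := 1 - τ) (by linarith)).comp
      (tendsto_natCast_atTop_atTop (R := ℝ))
    simpa [Function.comp_def] using this
  have := ge_of_tendsto hlim (eventually_atTop.2 ⟨1, fun n hn => key n hn⟩)
  linarith

/-- |φ_k| = |φ_k|^t |φ_k|^(1-t), with the uniform bound on the first factor and the decay on the
second: a little decay buys smallness. -/
theorem IsPolynomialSymbol.interpolate {s t ε : ℝ} {φ : IntLat d → ℝ} (hφ : IsPolynomialSymbol s φ)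
    (ht0 : 0 ≤ t) (ht1 : t ≤ 1) (hε : ∀ k, |φ k| ≤ ε) (k : IntLat d) :
    |φ k| ≤ ε ^ t * japanese k ^ (-(s * (1 - t))) := by
  have hε0 : 0 ≤ ε := (abs_nonneg _).trans (hε 0)
  have hj := japanese_pos k
  rcases eq_or_ne k 0 with rfl | hk
  · rw [hφ.2, abs_zero]; positivity
  rcases eq_or_ne (φ k) 0 with h0 | h0
  · rw [h0, abs_zero]; positivity
  have hpos : 0 < |φ k| := abs_pos.2 h0
  have h1 : |φ k| ^ (1 - t) ≤ japanese k ^ (-(s * (1 - t))) := by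
    rw [neg_mul_eq_neg_mul, Real.rpow_mul hj.le, japanese_eq_norm hk]
    exact Real.rpow_le_rpow hpos.le (hφ.1 k hk) (by linarith)
  calc |φ k| = |φ k| ^ t * |φ k| ^ (1 - t) := by
        rw [← Real.rpow_add hpos, add_sub_cancel, Real.rpow_one]
    _ ≤ _ := mul_le_mul (Real.rpow_le_rpow hpos.le (hε k) ht0) h1 (by positivity) (by positivity)

end Hypotheses

end

theorem mainTheorem8 (d : ℕ) (hd : 1 ≤ d) (α₀ τ δ s : ℝ)
    (hα₀ : (d : ℝ) / 2 < α₀) (hτ : 0 < τ) (hδ : 0 < δ)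
    (hs : α₀ + τ + (d : ℝ) / 2 + 12 * δ < s) :
    ∃ C : ℝ, 0 < C ∧ ∀ γ : ℝ, 0 < γ → ∃ ε₀ : ℝ, 0 < ε₀ ∧
      ∀ (ω : Fin d → ℝ) (φ : IntLat d → ℝ),
        IsDiophantine τ γ ω → IsPolynomialSymbol s φ →
        sobolevNorm ω (s - (d : ℝ) / 2 - δ) (hopping φ) ≤ ENNReal.ofReal ε₀ →
        ∃ d' : ℝ → ℝ, IsPeriodicBV d' ∧
          bvNorm (fun x : ℝ => Int.fract x - d' x) ≤
            ENNReal.ofReal C * sobolevNorm ω (s - (d : ℝ) / 2 - δ) (hopping φ) ^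
              (1 / (s - (d : ℝ) / 2 - 5 * δ - α₀)) ∧
          ∃ H : EllTwo d →L[ℂ] EllTwo d,
            IsOperatorOf H
              (hopping φ + Matrix.diagonal (fun i : IntLat d => (d' (phase ω i) : ℂ))) ∧
            HasPurePointSpectrum H ∧
            (∃ e : IntLat d → EllTwo d,
              (∀ k, ‖e k‖ = 1 ∧ H (e k) = ((Int.fract (phase ω k) : ℝ) : ℂ) • e k) ∧
              IsCompleteFamily e ∧
              ∀ i k : IntLat d,
                ‖e k i‖ ≤ 2 * japanese (i - k) ^ (-s + τ + (d : ℝ) / 2 + 12 * δ)) ∧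
            pointSpectrum H =
              Set.range (fun i : IntLat d => ((Int.fract (phase ω i) : ℝ) : ℂ)) := by
  have hd0 : (0 : ℝ) ≤ d := Nat.cast_nonneg d
  have hs0 : 0 < s := by linarith
  have hβ : (d : ℝ) < s - τ - δ := by linarith
  refine ⟨1, one_pos, fun γ hγ => ?_⟩
  set S := ∑' k : IntLat d, japanese k ^ (-(s - τ - δ)) with hSdef
  have hS : 0 ≤ S := tsum_nonneg fun k => (Real.rpow_pos_of_pos (japanese_pos k) _).le
  -- This η gives both η ≤ 1/2, for the diagonal entries, and ηS ≤ 1/2, for the Neumann series.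
  set η := 1 / (2 * (S + 1)) with hη
  have hη0 : 0 < η := by positivity
  have hη1 : η * (S + 1) = 1 / 2 := by rw [hη]; field_simp
  obtain ⟨ε, hε, hmain⟩ := exists_conjugacy (σ := τ + δ / 2) hβ hτ (by linarith) hγ hη0
  -- Interpolation with this t costs δ/2 of decay; the remaining s - δ/2 splits as β = s - τ - δ
  -- plus σ = τ + δ/2 > τ.
  set t := δ / (2 * s) with ht
  have ht0 : 0 < t := by positivity
  have ht1 : t ≤ 1 := by
    rw [ht, div_le_one (by positivity)]; linarith
  have hst : s * (1 - t) = s - τ - δ + (τ + δ / 2) := by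
    rw [ht]; field_simp; ring
  refine ⟨min 1 (ε ^ t⁻¹), by positivity, fun ω φ hω hφ hN => ?_⟩
  set N := sobolevNorm ω (s - (d : ℝ) / 2 - δ) (hopping φ) with hNdef
  have hNtop : N ≠ ⊤ := (hN.trans_lt ENNReal.ofReal_lt_top).ne
  have hNle : N.toReal ≤ min 1 (ε ^ t⁻¹) := ENNReal.toReal_le_of_le_ofReal (by positivity) hN
  have hφN : ∀ k, |φ k| ≤ N.toReal := fun k =>
    (ENNReal.ofReal_le_iff_le_toReal hNtop).1
      (ofReal_abs_le_sobolevNorm ω (by linarith) φ k)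
  have hφε : ∀ k, |φ k| ≤ ε * japanese k ^ (-(s - τ - δ + (τ + δ / 2))) := fun k => by
    refine (hφ.interpolate ht0.le ht1 hφN k).trans ?_
    rw [hst]
    refine mul_le_mul_of_nonneg_right ?_ (Real.rpow_pos_of_pos (japanese_pos k) _).le
    calc N.toReal ^ t ≤ (ε ^ t⁻¹) ^ t :=
          Real.rpow_le_rpow ENNReal.toReal_nonneg (hNle.trans (min_le_right _ _)) ht0.le
      _ = ε := Real.rpow_inv_rpow hε.le ht0.ne'
  obtain ⟨V, W, M, hP, hW, hdef⟩ := hmain ω φ hω hφε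
  have hη2 : η ≤ 1 / 2 := by nlinarith
  have hηS : η * S ≤ 1 / 2 := by nlinarith
  have hV := hasBVBound_correction hβ hφ.2 hφN hP hW hdef hη2 hηS
  obtain ⟨H, hH, hpp, ⟨e, he, hec, hdec⟩, hspec⟩ :=
    exists_eigenbasis hβ hφ.2 hP hW hdef hη2 hηS
  have hd' := hasBVBound_fract.add hV
  refine ⟨fun x => Int.fract x + V x, ⟨hd'.1, hd'.2.1.trans_lt ENNReal.ofReal_lt_top⟩, ?_,
    H, hH, hpp, ⟨e, he, hec, fun i k => (hdec i k).trans ?_⟩, hspec⟩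
  -- The denominator of the exponent exceeds τ + 7δ > 1, so N ≤ 1 gives N ≤ N^exponent.
  · have hτ1 := hω.one_le_exponent hd hγ hτ
    simp only [sub_add_cancel_left, ENNReal.ofReal_one, one_mul]
    refine hV.neg.2.1.trans ?_
    rw [ENNReal.ofReal_toReal hNtop]
    have hN1 : N ≤ 1 := by
      refine hN.trans ?_
      rw [← ENNReal.ofReal_one]
      exact ENNReal.ofReal_le_ofReal (min_le_left _ _)
    calc N = N ^ (1 : ℝ) := (ENNReal.rpow_one N).symm
      _ ≤ _ := ENNReal.rpow_le_rpow_of_exponent_ge hN1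
        ((div_le_one (by linarith)).2 (by linarith))
  · refine mul_le_mul_of_nonneg_left ?_ (by norm_num)
    exact Real.rpow_le_rpow_of_exponent_le (one_le_japanese _) (by linarith)
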